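/- **Theorem 4.** For $n\ge 1$ one observes $X=(X_1,\dots,X_n)$ with $X_i=\theta_i+\varepsilon_i$, $\varepsilon_1,\dots,\varepsilon_n$ i.i.d. $\mathcal N(0,1)$; $P_\theta$ denotes the law of $X$, $E_\theta$ the expectation under it, $\|\cdot\|$ the Euclidean norm on $\mathbb R^n$, and $\ell_0[s]=\{\theta\in\mathbb R^n:\ \#\{i:\theta_i\ne 0\}\le s\}$. Let $\lambda_0=5\sqrt{2\pi}\,n$ and $\lambda_1=0.05$, let $G_0=\mathrm{Lap}(\lambda_0)$ have density $\gamma_0(u)=\frac{\lambda_0}{2}e^{-\lambda_0|u|}$, and let $G_1=\mathrm{Cauchy}(1/\lambda_1)$ have density $\gamma_1(u)=\frac{\lambda_1}{\pi}(1+\lambda_1^2u^2)^{-1}$. For $\alpha\in[0,1]$ let $\Pi_\alpha=\bigotimes_{i=1}^n\{(1-\alpha)G_0+\alpha G_1\}$ be the spike and slab LASSO prior with Cauchy slab. With $\phi$ the standard normal density and $g_k(x)=\int\phi(x-u)\gamma_k(u)\,du$ for $k=0,1$, the posterior distribution is $$\Pi_\alpha[\,\cdot\,|\,X]=\bigotimes_{i=1}^n\big\{(1-a_\alpha(X_i))\,G_{0,X_i}+a_\alpha(X_i)\,G_{1,X_i}\big\},\qquad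 a_\alpha(x)=\frac{\alpha g_1(x)}{(1-\alpha)g_0(x)+\alpha g_1(x)},$$ where $G_{k,x}$ has density $u\mapsto\phi(x-u)\gamma_k(u)/g_k(x)$. For a constant $\mathcal C>0$ let $\hat\alpha=\hat\alpha(X)$ be a maximiser of the log-marginal likelihood $$\ell_n(\alpha;X)=\sum_{i=1}^n\log\big((1-\alpha)g_0(X_i)+\alpha g_1(X_i)\big)\quad\text{over }\alpha\in[\mathcal C\log n/n,\,1],$$ and let $\Pi_{\hat\alpha}[\,\cdot\,|\,X]$ be the plug-in posterior, that is $\Pi_\alpha[\,\cdot\,|\,X]$ at $\alpha=\hat\alpha(X)$. There exists $\mathcal C_0>0$ such that for every $\mathcal C\ge\mathcal C_0$ there exist $C>0$, $N_0>0$ and $c_0,c_1>0$ such that, for every $n\ge N_0$: 1. for every integer $s_n\ge 0$ with $c_1\log^2 n\le s_n\le c_0n$, $$\sup_{\theta_0\in\ell_0[s_n]}E_{\theta_0}\int\|\theta-\theta_0\|^2\,d\Pi_{\hat\alpha}(\theta\,|\,X)\le C\,s_n\log n;$$ 2. for every integer $s_n\ge 0$ with $s_n\le c_0n$, $$\sup_{\theta_0\in\ell_0[s_n]}E_{\theta_0}\int\|\theta-\theta_0\|^2\,d\Pi_{\hat\alpha}(\theta\,|\,X)\le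 C\,(s_n\log n+\log^3 n).$$ -/

import Mathlib

open MeasureTheory ProbabilityTheory
open scoped ENNReal

namespace SSL

noncomputable section

/-- The spike parameter `λ₀ = L₀ n`, with `L₀ = 5 √(2π)`. -/
def spikeParam (n : ℕ) : ℝ := 5 * √(2 * Real.pi) * n

/-- The slab parameter `λ₁ = 0.05`. -/
def slabParam : ℝ := 0.05

/-- The standard normal density `φ`. -/
def phi (x : ℝ) : ℝ := gaussianPDFReal 0 1 x

/-- The density `γ₀` of the Laplace distribution `G₀ = Lap(λ₀)`. -/
def spikeDensity (n : ℕ) (u : ℝ) : ℝ :=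
  spikeParam n / 2 * Real.exp (-(spikeParam n * |u|))

/-- The density `γ₁` of the Cauchy distribution `G₁` with location `0` and scale `1 / λ₁`. -/
def slabDensity (u : ℝ) : ℝ := cauchyPDFReal 0 (1 / slabParam).toNNReal u

/-- The convolution `∫ φ(x - u) γ(u) du` of `φ` with a density `γ`. -/
def convPhi (γ : ℝ → ℝ) (x : ℝ) : ℝ := ∫ u, phi (x - u) * γ u

/-- `g₀ = φ * γ₀`. -/
def g0 (n : ℕ) (x : ℝ) : ℝ := convPhi (spikeDensity n) x

/-- `g₁ = φ * γ₁`. -/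
def g1 (x : ℝ) : ℝ := convPhi slabDensity x

/-- The one-coordinate prior `(1 - α) G₀ + α G₁`. -/
def coordPrior (n : ℕ) (α : ℝ) : Measure ℝ :=
  ENNReal.ofReal (1 - α) • volume.withDensity (fun u => ENNReal.ofReal (spikeDensity n u)) +
    ENNReal.ofReal α • volume.withDensity (fun u => ENNReal.ofReal (slabDensity u))

/-- The spike and slab LASSO prior with Cauchy slab, `Π_α = ⊗ᵢ ((1 - α) G₀ + α G₁)`. -/
def prior (n : ℕ) (α : ℝ) : Measure (Fin n → ℝ) := Measure.pi fun _ => coordPrior n α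

/-- The posterior weight `a_α(x) = α g₁(x) / ((1 - α) g₀(x) + α g₁(x))`. -/
def postWeight (n : ℕ) (α x : ℝ) : ℝ := α * g1 x / ((1 - α) * g0 n x + α * g1 x)

/-- For a prior density `γ`, the distribution with density
`γ_x(u) = φ(x - u) γ(u) / (φ * γ)(x)`. -/
def postComponent (γ : ℝ → ℝ) (x : ℝ) : Measure ℝ :=
  volume.withDensity fun u => ENNReal.ofReal (phi (x - u) * γ u / convPhi γ x)

/-- The one-coordinate posterior `(1 - a(x)) G_{0,x} + a(x) G_{1,x}`. -/
def coordPosterior (n : ℕ) (α x : ℝ) : Measure ℝ :=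
  ENNReal.ofReal (1 - postWeight n α x) • postComponent (spikeDensity n) x +
    ENNReal.ofReal (postWeight n α x) • postComponent slabDensity x

/-- The posterior distribution `Π_α[· | X] = ⊗ᵢ ((1 - a(Xᵢ)) G_{0,Xᵢ} + a(Xᵢ) G_{1,Xᵢ})`. It is
the Bayes posterior of `prior n α`, see `posterior_eq_bayes`. -/
def posterior (n : ℕ) (α : ℝ) (X : Fin n → ℝ) : Measure (Fin n → ℝ) :=
  Measure.pi fun i => coordPosterior n α (X i)

/-- The log-marginal likelihood `ℓ_n(α; X) = ∑ᵢ log ((1 - α) g₀(Xᵢ) + α g₁(Xᵢ))`. -/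
def logMarginal (n : ℕ) (α : ℝ) (X : Fin n → ℝ) : ℝ :=
  ∑ i, Real.log ((1 - α) * g0 n (X i) + α * g1 (X i))

/-- `αhat` is a marginal maximum likelihood estimator: for every observation `X`, the value
`αhat X` is a maximiser of `ℓ_n(·; X)` over the interval `[c log n / n, 1]`. -/
def IsMMLE (c : ℝ) (n : ℕ) (αhat : (Fin n → ℝ) → ℝ) : Prop :=
  ∀ X : Fin n → ℝ, αhat X ∈ Set.Icc (c * Real.log n / n) 1 ∧
    IsMaxOn (fun α => logMarginal n α X) (Set.Icc (c * Real.log n / n) 1) (αhat X)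

/-- The class `ℓ₀[s]` of vectors with at most `s` nonzero coordinates. -/
def sparseClass (n s : ℕ) : Set (Fin n → ℝ) :=
  {θ | (Finset.univ.filter fun i => θ i ≠ 0).card ≤ s}

/-- The law `P_θ` of `X = θ + ε` with `ε₁, …, ε_n` i.i.d. standard normal. -/
def sampleLaw {n : ℕ} (θ : Fin n → ℝ) : Measure (Fin n → ℝ) :=
  Measure.pi fun i => gaussianReal (θ i) 1

/-- The risk `E_{θ₀} ∫ ‖θ - θ₀‖² dΠ_{αhat}(θ | X)` of the plug-in posterior, with the squared
Euclidean norm, as an element of `[0, ∞]`. -/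
def plugInRisk {n : ℕ} (αhat : (Fin n → ℝ) → ℝ) (θ₀ : Fin n → ℝ) : ℝ≥0∞ :=
  ∫⁻ X, ∫⁻ θ, ENNReal.ofReal (∑ i, (θ i - θ₀ i) ^ 2) ∂(posterior n (αhat X) X) ∂(sampleLaw θ₀)

/-! ### Sanity facts: the densities, and Bayes' formula -/

lemma slabDensity_eq (u : ℝ) :
    slabDensity u = slabParam / Real.pi * (1 + slabParam ^ 2 * u ^ 2)⁻¹ := by
  have h : (0 : ℝ) ≤ 1 / slabParam := by norm_num [slabParam]
  rw [slabDensity, cauchyPDFReal_def', NNReal.coe_inv, Real.coe_toNNReal _ h]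
  norm_num [slabParam]
  ring

lemma spikeParam_pos {n : ℕ} (hn : 0 < n) : 0 < spikeParam n := by
  have : (0 : ℝ) < n := by exact_mod_cast hn
  unfold spikeParam
  positivity

lemma phi_pos (x : ℝ) : 0 < phi x := gaussianPDFReal_pos 0 1 x one_ne_zero

lemma measurable_phi : Measurable phi := measurable_gaussianPDFReal 0 1

lemma phi_le_one (x : ℝ) : phi x ≤ 1 := by
  unfold phi gaussianPDFReal
  have h1 : (1 : ℝ) ≤ √(2 * Real.pi * ((1 : NNReal) : ℝ)) := by
    rw [Real.one_le_sqrt]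
    have := Real.pi_gt_three
    simp only [NNReal.coe_one]
    linarith
  have h2 : Real.exp (-(x - 0) ^ 2 / (2 * ((1 : NNReal) : ℝ))) ≤ 1 := by
    rw [Real.exp_le_one_iff]
    simp only [NNReal.coe_one]
    nlinarith [sq_nonneg (x - 0)]
  exact mul_le_one₀ (inv_le_one_of_one_le₀ h1) (Real.exp_pos _).le h2

lemma slabDensity_pos (u : ℝ) : 0 < slabDensity u := by
  rw [slabDensity_eq]
  have := Real.pi_pos
  norm_num [slabParam]
  positivity

lemma spikeDensity_pos {n : ℕ} (hn : 0 < n) (u : ℝ) : 0 < spikeDensity n u := by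
  have := spikeParam_pos hn
  unfold spikeDensity
  positivity

lemma measurable_slabDensity : Measurable slabDensity := measurable_cauchyPDFReal _ _

lemma measurable_spikeDensity (n : ℕ) : Measurable (spikeDensity n) := by
  unfold spikeDensity
  fun_prop

lemma integral_slabDensity : ∫ u, slabDensity u = 1 :=
  integral_cauchyPDFReal_eq_one 0 (by norm_num [slabParam])

lemma integral_spikeDensity {n : ℕ} (hn : 0 < n) : ∫ u, spikeDensity n u = 1 := by
  have h := spikeParam_pos hn
  have h1 := integral_comp_abs (f := fun u => spikeParam n / 2 * Real.exp (-(spikeParam n) * u))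
  have h2 := integral_exp_mul_Ioi (a := -spikeParam n) (by linarith) 0
  simp only [spikeDensity, ← neg_mul]
  rw [h1, integral_const_mul, h2]
  simp
  field_simp

/-- Each mixture component of the posterior is obtained from Bayes' formula. -/
lemma component_bayes {γ : ℝ → ℝ} (hm : Measurable γ) (hpos : ∀ u, 0 < γ u)
    (hint : ∫ u, γ u = 1) (x : ℝ) :
    0 < convPhi γ x ∧ IsProbabilityMeasure (postComponent γ x) ∧
    IsProbabilityMeasure (volume.withDensity fun u => ENNReal.ofReal (γ u)) ∧
    (volume.withDensity fun u => ENNReal.ofReal (γ u)).withDensity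
        (fun u => ENNReal.ofReal (phi (x - u))) =
      ENNReal.ofReal (convPhi γ x) • postComponent γ x := by
  have hγ : Integrable γ := by
    by_contra h
    rw [integral_undef h] at hint
    norm_num at hint
  have hmp : Measurable fun u => phi (x - u) := measurable_phi.comp (by fun_prop)
  have hI : Integrable fun u => phi (x - u) * γ u := by
    refine hγ.mono (hmp.mul hm).aestronglyMeasurable (Filter.Eventually.of_forall fun u => ?_)
    rw [Real.norm_eq_abs, Real.norm_eq_abs, abs_mul, abs_of_pos (phi_pos _)]
    exact mul_le_of_le_one_left (abs_nonneg _) (phi_le_one _)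
  have hc : 0 < convPhi γ x := by
    unfold convPhi
    rw [integral_pos_iff_support_of_nonneg (fun u => (mul_pos (phi_pos _) (hpos u)).le) hI]
    have : (Function.support fun u => phi (x - u) * γ u) = Set.univ := by
      ext u
      simpa using ⟨(phi_pos _).ne', (hpos u).ne'⟩
    rw [this]
    simp
  refine ⟨hc, ⟨?_⟩, ⟨?_⟩, ?_⟩
  · rw [postComponent, withDensity_apply _ MeasurableSet.univ, Measure.restrict_univ,
      ← ofReal_integral_eq_lintegral_ofReal (hI.div_const _)
        (Filter.Eventually.of_forall fun u => div_nonneg (mul_pos (phi_pos _) (hpos u)).le hc.le),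
      integral_div]
    change ENNReal.ofReal (convPhi γ x / convPhi γ x) = 1
    rw [div_self hc.ne', ENNReal.ofReal_one]
  · rw [withDensity_apply _ MeasurableSet.univ, Measure.restrict_univ,
      ← ofReal_integral_eq_lintegral_ofReal hγ (Filter.Eventually.of_forall fun u => (hpos u).le),
      hint, ENNReal.ofReal_one]
  · rw [← withDensity_mul _ hm.ennreal_ofReal hmp.ennreal_ofReal, postComponent,
      ← withDensity_smul' _ _ ENNReal.ofReal_ne_top]
    congr 1
    ext u
    simp only [Pi.mul_apply, Pi.smul_apply, smul_eq_mul]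
    rw [← ENNReal.ofReal_mul (hpos u).le, ← ENNReal.ofReal_mul hc.le]
    congr 1
    field_simp

/-- One-coordinate Bayes' formula, with the marginal density `(1 - α) g₀ + α g₁`. -/
lemma coord_bayes {n : ℕ} (hn : 0 < n) {α : ℝ} (hα : α ∈ Set.Icc (0 : ℝ) 1) (x : ℝ) :
    0 < (1 - α) * g0 n x + α * g1 x ∧ IsProbabilityMeasure (coordPosterior n α x) ∧
    IsProbabilityMeasure (coordPrior n α) ∧
    (coordPrior n α).withDensity (fun u => ENNReal.ofReal (phi (x - u))) =
      ENNReal.ofReal ((1 - α) * g0 n x + α * g1 x) • coordPosterior n α x := by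
  obtain ⟨h0, p0, q0, e0⟩ :=
    component_bayes (measurable_spikeDensity n) (spikeDensity_pos hn) (integral_spikeDensity hn) x
  obtain ⟨h1, p1, q1, e1⟩ :=
    component_bayes measurable_slabDensity slabDensity_pos integral_slabDensity x
  change 0 < g0 n x at h0
  change 0 < g1 x at h1
  have hα0 := hα.1
  have hα1 : 0 ≤ 1 - α := by linarith [hα.2]
  have hm : 0 < (1 - α) * g0 n x + α * g1 x := by
    rcases hα0.eq_or_lt with h | h
    · rw [← h]; simpa using h0
    · have := mul_nonneg hα1 h0.le
      have := mul_pos h h1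
      linarith
  have ha0 : 0 ≤ postWeight n α x := div_nonneg (mul_nonneg hα0 h1.le) hm.le
  have ha : 1 - postWeight n α x = (1 - α) * g0 n x / ((1 - α) * g0 n x + α * g1 x) := by
    unfold postWeight
    field_simp
    ring
  have ha1 : 0 ≤ 1 - postWeight n α x := by
    rw [ha]
    exact div_nonneg (mul_nonneg hα1 h0.le) hm.le
  refine ⟨hm, ⟨?_⟩, ⟨?_⟩, ?_⟩
  · simp only [coordPosterior, Measure.add_apply, Measure.smul_apply, measure_univ, smul_eq_mul,
      mul_one]
    rw [← ENNReal.ofReal_add ha1 ha0]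
    simp
  · simp only [coordPrior, Measure.add_apply, Measure.smul_apply, measure_univ, smul_eq_mul,
      mul_one]
    rw [← ENNReal.ofReal_add hα1 hα0]
    simp
  · rw [coordPrior, withDensity_add_measure, withDensity_smul_measure, withDensity_smul_measure,
      e0, e1, coordPosterior, smul_add, smul_smul, smul_smul, smul_smul, smul_smul,
      ← ENNReal.ofReal_mul hα1, ← ENNReal.ofReal_mul hα0, ← ENNReal.ofReal_mul hm.le,
      ← ENNReal.ofReal_mul hm.le, ha, mul_div_cancel₀ _ hm.ne', postWeight,
      mul_div_cancel₀ _ hm.ne']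
    rfl

/-- The likelihood `θ ↦ ∏ᵢ φ(Xᵢ - θᵢ)` of the observation `X`. -/
def likelihood {n : ℕ} (X θ : Fin n → ℝ) : ℝ≥0∞ := ∏ i, ENNReal.ofReal (phi (X i - θ i))

lemma lintegral_likelihood_box {n : ℕ} (hn : 0 < n) {α : ℝ} (hα : α ∈ Set.Icc (0 : ℝ) 1)
    (X : Fin n → ℝ) {s : Fin n → Set ℝ} (hs : ∀ i, MeasurableSet (s i)) :
    ∫⁻ θ in Set.univ.pi s, likelihood X θ ∂(prior n α) =
      (∏ i, ENNReal.ofReal ((1 - α) * g0 n (X i) + α * g1 (X i))) *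
        ∏ i, coordPosterior n α (X i) (s i) := by
  have hp : IsProbabilityMeasure (coordPrior n α) := (coord_bayes hn hα 0).2.2.1
  have hmp : ∀ i, Measurable fun u => ENNReal.ofReal (phi (X i - u)) := fun i =>
    (measurable_phi.comp (by fun_prop)).ennreal_ofReal
  let f : Fin n → ℝ → ℝ≥0∞ := fun i => (s i).indicator fun u => ENNReal.ofReal (phi (X i - u))
  have hf : ∀ i, Measurable (f i) := fun i => (hmp i).indicator (hs i)
  have hind : iIndepFun (fun i (θ : Fin n → ℝ) => f i (θ i)) (prior n α) :=
    iIndepFun_pi fun i => (hf i).aemeasurable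
  have key := lintegral_prod_eq_prod_lintegral_of_indepFun Finset.univ _ hind
    (fun i => (hf i).comp (measurable_pi_apply i))
  have hL : ∀ θ : Fin n → ℝ,
      (Set.univ.pi s).indicator (likelihood X) θ = ∏ i, f i (θ i) := by
    intro θ
    by_cases h : θ ∈ Set.univ.pi s
    · rw [Set.indicator_of_mem h]
      refine Finset.prod_congr rfl fun i _ => ?_
      have h0 : f i (θ i) = ENNReal.ofReal (phi (X i - θ i)) :=
        Set.indicator_of_mem (h i (Set.mem_univ i)) _
      exact h0.symm
    · rw [Set.indicator_of_notMem h]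
      simp only [Set.mem_pi, Set.mem_univ, true_implies, not_forall] at h
      obtain ⟨i, hi⟩ := h
      have h0 : f i (θ i) = 0 :=
        Set.indicator_of_notMem (M := ℝ≥0∞) hi _
      exact (Finset.prod_eq_zero (Finset.mem_univ i) h0).symm
  rw [← lintegral_indicator (MeasurableSet.univ_pi hs), lintegral_congr hL, key,
    ← Finset.prod_mul_distrib]
  refine Finset.prod_congr rfl fun i _ => ?_
  have h1 : ∫⁻ θ, f i (θ i) ∂(prior n α) = ∫⁻ u, f i u ∂(coordPrior n α) :=
    (measurePreserving_eval (fun _ : Fin n => coordPrior n α) i).lintegral_comp (hf i)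
  rw [h1, lintegral_indicator (hs i), ← withDensity_apply _ (hs i), (coord_bayes hn hα (X i)).2.2.2]
  rfl

/-- Bayes' formula: the product form `posterior` is the prior, reweighted by the likelihood and
normalised. -/
theorem posterior_eq_bayes {n : ℕ} (hn : 0 < n) {α : ℝ} (hα : α ∈ Set.Icc (0 : ℝ) 1)
    (X : Fin n → ℝ) :
    posterior n α X = (∫⁻ θ, likelihood X θ ∂(prior n α))⁻¹ •
      (prior n α).withDensity (likelihood X) := by
  have hp : ∀ i, IsProbabilityMeasure (coordPosterior n α (X i)) := fun i =>
    (coord_bayes hn hα (X i)).2.1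
  have hZ := lintegral_likelihood_box hn hα X (s := fun _ => Set.univ) fun _ => MeasurableSet.univ
  simp only [Set.pi_univ, Measure.restrict_univ, measure_univ, Finset.prod_const_one,
    mul_one] at hZ
  refine Measure.pi_eq fun s hs => ?_
  rw [Measure.smul_apply, withDensity_apply _ (MeasurableSet.univ_pi hs),
    lintegral_likelihood_box hn hα X hs, hZ, smul_eq_mul, ← mul_assoc, ENNReal.inv_mul_cancel,
    one_mul]
  · exact Finset.prod_ne_zero_iff.2 fun i _ => by
      simpa using (coord_bayes hn hα (X i)).1
  · exact ENNReal.prod_ne_top fun i _ => ENNReal.ofReal_ne_top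

/-- A maximiser of the marginal likelihood exists whenever `0 < c log n / n ≤ 1`. -/
theorem exists_isMMLE {c : ℝ} {n : ℕ} (hn : 0 < n) (h0 : 0 < c * Real.log n / n)
    (h1 : c * Real.log n / n ≤ 1) : ∃ αhat : (Fin n → ℝ) → ℝ, IsMMLE c n αhat := by
  have key : ∀ X : Fin n → ℝ, ∃ a ∈ Set.Icc (c * Real.log n / n) 1,
      IsMaxOn (fun α => logMarginal n α X) (Set.Icc (c * Real.log n / n) 1) a := by
    intro X
    refine isCompact_Icc.exists_isMaxOn (Set.nonempty_Icc.2 h1) ?_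
    unfold logMarginal
    refine continuousOn_finsetSum _ fun i _ => ContinuousOn.log (by fun_prop) fun α hα => ?_
    exact (coord_bayes hn ⟨h0.le.trans hα.1, hα.2⟩ (X i)).1.ne'
  choose αhat h using key
  exact ⟨αhat, h⟩

end

end SSL

/-!
The risk of the plug-in posterior is the sum of the risks of the coordinate posteriors. A nonzero
coordinate costs at most a multiple of `log n`, because the estimated weight is at least `1 / n` and
the tails of the slab are heavy. A null coordinate costs little unless its posterior weight on the
slab is large, and that weight increases with `α`; it remains to show that `α̂` rarely exceeds a
multiple of `(s √(log n) + log² n) / n`.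

If `α < α̂`, then by concavity of the log-marginal likelihood the score at `α` is nonnegative. Each
nonzero coordinate contributes at most `1 / α` to the score. Under `N(0, 1)` the score of a null
coordinate would have mean close to zero if its denominator were `g₀ ≈ φ`, since `g₁` and `φ` both
integrate to one; on the window `[T, 2T]` with `T` of order `√(log n)` the slab dominates and the
score is smaller than `g₁ / g₀ - 1`, which yields a mean of at most `-1 / (24000 T)`. Chernoff's
inequality for the sum over the null coordinates then bounds the probability of the event by `n⁻²`.
-/

namespace SSL

noncomputable section

/-! ### Gaussian integrals -/

lemma phi_eq (x : ℝ) : phi x = (√(2 * Real.pi))⁻¹ * Real.exp (-x ^ 2 / 2) := by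
  simp [phi, gaussianPDFReal]

lemma phi_le_exp (x : ℝ) : phi x ≤ Real.exp (-x ^ 2 / 2) := by
  rw [phi_eq]
  refine mul_le_of_le_one_left (Real.exp_pos _).le (inv_le_one_of_one_le₀ ?_)
  rw [Real.one_le_sqrt]
  linarith [Real.pi_gt_three]

lemma phi_neg (x : ℝ) : phi (-x) = phi x := by rw [phi_eq, phi_eq, neg_sq]

lemma integral_phi : ∫ x, phi x = 1 := integral_gaussianPDFReal_eq_one 0 one_ne_zero

lemma integrable_phi : Integrable phi := integrable_gaussianPDFReal 0 1

lemma gaussianPDFReal_eq_phi_sub (x u : ℝ) : gaussianPDFReal x 1 u = phi (x - u) := by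
  rw [phi, gaussianPDFReal, gaussianPDFReal, sub_zero, ← neg_sub x u, neg_sq]

lemma integral_gaussianReal_eq_integral_phi_mul (F : ℝ → ℝ) (x : ℝ) :
    ∫ u, F u ∂gaussianReal x 1 = ∫ u, phi (x - u) * F u := by
  simp only [integral_gaussianReal_eq_integral_smul one_ne_zero, gaussianPDFReal_eq_phi_sub,
    smul_eq_mul]

lemma integrable_gaussianReal_iff {F : ℝ → ℝ} {x : ℝ} :
    Integrable F (gaussianReal x 1) ↔ Integrable fun u => phi (x - u) * F u := by
  rw [gaussianReal_of_var_ne_zero x one_ne_zero, integrable_withDensity_iff_integrable_smul'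
    (measurable_gaussianPDF x 1) (ae_of_all _ fun _ => gaussianPDF_lt_top)]
  simp only [toReal_gaussianPDF, gaussianPDFReal_eq_phi_sub, smul_eq_mul]

lemma measurePreserving_sub_gaussianReal (x : ℝ) :
    MeasurePreserving (fun u => u - x) (gaussianReal x 1) (gaussianReal 0 1) :=
  ⟨by fun_prop, by rw [gaussianReal_map_sub_const, sub_self]⟩

lemma integrable_sq_gaussianReal (x : ℝ) :
    Integrable (fun u : ℝ => u ^ 2) (gaussianReal x 1) :=
  (memLp_id_gaussianReal 2).integrable_sq

lemma integral_sq_gaussianReal (x : ℝ) : ∫ u, u ^ 2 ∂gaussianReal x 1 = x ^ 2 + 1 := by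
  have h := variance_eq_sub (memLp_id_gaussianReal (μ := x) (v := 1) 2)
  simp only [variance_id_gaussianReal, NNReal.coe_one, Pi.pow_apply, id_eq,
    integral_id_gaussianReal] at h
  linarith

lemma integrable_sub_sq_gaussianReal (x : ℝ) :
    Integrable (fun u => (u - x) ^ 2) (gaussianReal x 1) :=
  (measurePreserving_sub_gaussianReal x).integrable_comp_of_integrable
    (integrable_sq_gaussianReal 0)

lemma integral_sub_sq_gaussianReal (x : ℝ) : ∫ u, (u - x) ^ 2 ∂gaussianReal x 1 = 1 := by
  have h := variance_eq_integral (μ := gaussianReal x 1) aemeasurable_id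
  simpa only [variance_id_gaussianReal, NNReal.coe_one, id_eq, integral_id_gaussianReal]
    using h.symm

lemma pow_two_mul_le_exp (k : ℕ) (x : ℝ) :
    x ^ (2 * k) ≤ 4 ^ k * k.factorial * Real.exp (x ^ 2 / 4) := by
  have h := Real.pow_div_factorial_le_exp (x ^ 2 / 4) (by positivity) k
  rw [div_pow, ← pow_mul, div_div, div_le_iff₀ (by positivity)] at h
  linarith

lemma sq_le_exp (x : ℝ) : x ^ 2 ≤ 4 * Real.exp (x ^ 2 / 4) := by
  simpa using pow_two_mul_le_exp 1 x

lemma pow_four_le_exp (x : ℝ) : x ^ 4 ≤ 32 * Real.exp (x ^ 2 / 4) := by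
  have h := pow_two_mul_le_exp 2 x
  norm_num [Nat.factorial] at h
  exact h

lemma phi_mul_exp (x : ℝ) :
    phi x * Real.exp (x ^ 2 / 4) = (√(2 * Real.pi))⁻¹ * Real.exp (-(1 / 4) * x ^ 2) := by
  rw [phi_eq, mul_assoc, ← Real.exp_add]
  ring_nf

lemma integrable_phi_mul_exp : Integrable fun x => phi x * Real.exp (x ^ 2 / 4) := by
  simp_rw [phi_mul_exp]
  exact (integrable_exp_neg_mul_sq (by norm_num)).const_mul _

lemma integral_phi_mul_exp : ∫ x, phi x * Real.exp (x ^ 2 / 4) = √2 := by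
  simp_rw [phi_mul_exp]
  rw [integral_const_mul, integral_gaussian, ← Real.sqrt_inv, ← Real.sqrt_mul (by positivity)]
  congr 1
  field_simp
  norm_num

lemma integral_phi_mul_exp_le : ∫ x, phi x * Real.exp (x ^ 2 / 4) ≤ 3 / 2 := by
  rw [integral_phi_mul_exp, Real.sqrt_le_left (by norm_num)]
  norm_num

lemma integrable_exp_sub_sq_gaussianReal (x : ℝ) :
    Integrable (fun u => Real.exp ((u - x) ^ 2 / 4)) (gaussianReal x 1) :=
  (measurePreserving_sub_gaussianReal x).integrable_comp_of_integrable
    (g := fun u => Real.exp (u ^ 2 / 4)) (integrable_gaussianReal_iff.2 (by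
      simpa only [zero_sub, phi_neg] using integrable_phi_mul_exp))

lemma integral_exp_sub_sq_gaussianReal_le (x : ℝ) :
    ∫ u, Real.exp ((u - x) ^ 2 / 4) ∂gaussianReal x 1 ≤ 3 / 2 := by
  rw [integral_gaussianReal_eq_integral_phi_mul]
  have h := integral_sub_left_eq_self (fun w => phi w * Real.exp (w ^ 2 / 4)) volume x
  simp only [← neg_sub x, neg_sq]
  exact h.trans_le integral_phi_mul_exp_le

/-- No measurability of `F` is assumed: a maximiser `αhat` need not be measurable. -/
lemma lintegral_gaussian_le {F H : ℝ → ℝ} {B : ℝ} (hF : ∀ x, 0 ≤ F x)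
    (hFH : ∀ x, phi x * F x ≤ H x) (hH : Integrable H) (hB : ∫ x, H x ≤ B) :
    ∫⁻ x, ENNReal.ofReal (F x) ∂(gaussianReal 0 1) ≤ ENNReal.ofReal B := by
  have h0 : ∀ x, 0 ≤ H x := fun x => (mul_nonneg (phi_pos x).le (hF x)).trans (hFH x)
  calc ∫⁻ x, ENNReal.ofReal (F x) ∂(gaussianReal 0 1)
      ≤ ∫⁻ x, ENNReal.ofReal (phi x) * ENNReal.ofReal (F x) := by
        rw [gaussianReal_of_var_ne_zero 0 one_ne_zero]
        exact lintegral_withDensity_le_lintegral_mul _ (measurable_gaussianPDF 0 1) _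
    _ ≤ ∫⁻ x, ENNReal.ofReal (H x) := by
        refine lintegral_mono fun x => ?_
        rw [← ENNReal.ofReal_mul (phi_pos x).le]
        exact ENNReal.ofReal_le_ofReal (hFH x)
    _ = ENNReal.ofReal (∫ x, H x) :=
        (ofReal_integral_eq_lintegral_ofReal hH (ae_of_all _ h0)).symm
    _ ≤ ENNReal.ofReal B := ENNReal.ofReal_le_ofReal hB

lemma lintegral_gaussian_le_of_le_exp {F : ℝ → ℝ} {C : ℝ} (hF : ∀ x, 0 ≤ F x)
    (h : ∀ x, F x ≤ C * Real.exp (x ^ 2 / 4)) :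
    ∫⁻ x, ENNReal.ofReal (F x) ∂(gaussianReal 0 1) ≤ ENNReal.ofReal (2 * C) := by
  have hC : 0 ≤ C := by simpa using (hF 0).trans (h 0)
  refine lintegral_gaussian_le hF (H := fun x => C * (phi x * Real.exp (x ^ 2 / 4)))
    (fun x => ?_) (integrable_phi_mul_exp.const_mul C) ?_
  · linarith [mul_le_mul_of_nonneg_left (h x) (phi_pos x).le]
  · rw [integral_const_mul]
    linarith [mul_le_mul_of_nonneg_left integral_phi_mul_exp_le hC]

/-! ### Gaussian convolutions -/

lemma convPhi_eq_integral (γ : ℝ → ℝ) (x : ℝ) : convPhi γ x = ∫ u, γ u ∂gaussianReal x 1 :=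
  (integral_gaussianReal_eq_integral_phi_mul γ x).symm

lemma integrable_phi_sub_mul {γ : ℝ → ℝ} (hγ : Integrable γ) (x : ℝ) :
    Integrable fun u => phi (x - u) * γ u := by
  refine hγ.bdd_mul (c := 1) (measurable_phi.comp (by fun_prop)).aestronglyMeasurable
    (ae_of_all _ fun u => ?_)
  rw [Real.norm_eq_abs, abs_of_pos (phi_pos _)]
  exact phi_le_one _

lemma integrable_gaussianReal {γ : ℝ → ℝ} (hγ : Integrable γ) (x : ℝ) :
    Integrable γ (gaussianReal x 1) :=
  integrable_gaussianReal_iff.2 (integrable_phi_sub_mul hγ x)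

lemma convPhi_eq_convolution (γ : ℝ → ℝ) :
    convPhi γ = convolution γ phi (ContinuousLinearMap.mul ℝ ℝ) volume := by
  ext x
  simp only [convPhi, convolution, ContinuousLinearMap.mul_apply', mul_comm]

lemma integrable_convPhi {γ : ℝ → ℝ} (hγ : Integrable γ) : Integrable (convPhi γ) := by
  rw [convPhi_eq_convolution]
  exact hγ.integrable_convolution _ integrable_phi

lemma integral_convPhi {γ : ℝ → ℝ} (hγ : Integrable γ) : ∫ x, convPhi γ x = ∫ u, γ u := by
  rw [convPhi_eq_convolution, integral_convolution _ hγ integrable_phi]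
  simp [integral_phi]

lemma measurable_convPhi {γ : ℝ → ℝ} (hγ : Measurable γ) : Measurable (convPhi γ) := by
  have h : StronglyMeasurable (Function.uncurry fun x u : ℝ => phi (x - u) * γ u) :=
    ((measurable_phi.comp (by fun_prop)).mul (hγ.comp (by fun_prop))).stronglyMeasurable
  exact h.integral_prod_right.measurable

/-- Chebyshev's association inequality: `u ^ 2` and `γ u` are oppositely ordered. -/
lemma integral_sq_mul_le_of_antitone {γ : ℝ → ℝ}
    (hanti : ∀ u v, |u| ≤ |v| → γ v ≤ γ u) {x : ℝ} (hγ : Integrable γ (gaussianReal x 1))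
    (hsq : Integrable (fun u => u ^ 2 * γ u) (gaussianReal x 1)) :
    ∫ u, u ^ 2 * γ u ∂gaussianReal x 1 ≤ (x ^ 2 + 1) * convPhi γ x := by
  set M : ℝ := x ^ 2 + 1
  set g : ℝ := γ (√M)
  have hM : |√M| = √M := abs_of_nonneg (Real.sqrt_nonneg M)
  have hopp : ∀ u, u ^ 2 * γ u - M * γ u ≤ u ^ 2 * g - M * g := fun u => by
    rcases le_total (u ^ 2) M with h | h
    · have : g ≤ γ u := hanti u _ (hM.symm ▸ Real.abs_le_sqrt h)
      nlinarith
    · have : γ u ≤ g := hanti _ u (by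
        rw [hM, ← Real.sqrt_sq_eq_abs]
        exact Real.sqrt_le_sqrt h)
      nlinarith
  have h := integral_mono (hsq.sub (hγ.const_mul M))
    (((integrable_sq_gaussianReal x).mul_const g).sub (integrable_const (M * g))) hopp
  simp only [Pi.sub_apply] at h
  rw [integral_sub hsq (hγ.const_mul M), integral_const_mul,
    integral_sub ((integrable_sq_gaussianReal x).mul_const g) (integrable_const _),
    integral_mul_const, integral_sq_gaussianReal, integral_const, probReal_univ, one_smul,
    sub_self] at h
  rw [convPhi_eq_integral]
  linarith

lemma phi_sub_eq (x u : ℝ) : phi (x - u) = phi x * Real.exp (x * u - u ^ 2 / 2) := by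
  rw [phi_eq, phi_eq, mul_assoc, ← Real.exp_add]
  ring_nf

lemma phi_mul_two_sub_sq_le (x u : ℝ) : phi x * (2 - u ^ 2) ≤ phi (x - u) + phi (x + u) := by
  have h1 := Real.add_one_le_exp (x * u - u ^ 2 / 2)
  have h2 := Real.add_one_le_exp (x * -u - (-u) ^ 2 / 2)
  rw [← sub_neg_eq_add x u, phi_sub_eq x u, phi_sub_eq x (-u), ← mul_add]
  exact mul_le_mul_of_nonneg_left (by linarith) (phi_pos x).le

lemma phi_mul_one_sub_le_convPhi {γ : ℝ → ℝ} (hpos : ∀ u, 0 ≤ γ u) (heven : ∀ u, γ (-u) = γ u)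
    (hint : ∫ u, γ u = 1) (hsq : Integrable fun u => u ^ 2 * γ u) (x : ℝ) :
    phi x * (1 - (∫ u, u ^ 2 * γ u) / 2) ≤ convPhi γ x := by
  have hγ : Integrable γ := integrable_of_integral_eq_one hint
  have hI := integrable_phi_sub_mul hγ x
  have hI' : Integrable fun u => phi (x + u) * γ u := by
    simpa only [sub_neg_eq_add, heven] using hI.comp_neg
  have hsymm : ∫ u, phi (x + u) * γ u = ∫ u, phi (x - u) * γ u := by
    simpa only [sub_neg_eq_add, heven] using
      integral_neg_eq_self (fun u => phi (x - u) * γ u) volume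
  have h := integral_mono (((hγ.const_mul 2).sub hsq).const_mul (phi x)) (hI.add hI') fun u => by
    have := mul_le_mul_of_nonneg_right (phi_mul_two_sub_sq_le x u) (hpos u)
    simp only [Pi.sub_apply, Pi.add_apply]
    linarith
  simp only [Pi.sub_apply, Pi.add_apply] at h
  rw [integral_const_mul, integral_sub (hγ.const_mul 2) hsq, integral_const_mul, hint,
    integral_add hI hI', hsymm] at h
  rw [convPhi]
  linarith

lemma lintegral_postComponent_le {γ h : ℝ → ℝ} {x V : ℝ} (hγ : ∀ u, 0 ≤ γ u) (hh : ∀ u, 0 ≤ h u)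
    (hm : Measurable γ) (hc : 0 < convPhi γ x)
    (hI : Integrable (fun u => h u * γ u) (gaussianReal x 1))
    (hV : ∫ u, h u * γ u ∂gaussianReal x 1 ≤ V * convPhi γ x) :
    ∫⁻ u, ENNReal.ofReal (h u) ∂(postComponent γ x) ≤ ENNReal.ofReal V := by
  have hd : Measurable fun u => ENNReal.ofReal (phi (x - u) * γ u / convPhi γ x) :=
    (((measurable_phi.comp (by fun_prop)).mul hm).div_const _).ennreal_ofReal
  have hp : ∀ u, 0 ≤ phi (x - u) * γ u / convPhi γ x := fun u =>
    div_nonneg (mul_nonneg (phi_pos _).le (hγ u)) hc.le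
  rw [integrable_gaussianReal_iff] at hI
  rw [integral_gaussianReal_eq_integral_phi_mul] at hV
  calc ∫⁻ u, ENNReal.ofReal (h u) ∂(postComponent γ x)
      ≤ ∫⁻ u, ENNReal.ofReal (phi (x - u) * γ u / convPhi γ x) * ENNReal.ofReal (h u) :=
        lintegral_withDensity_le_lintegral_mul _ hd _
    _ = ∫⁻ u, ENNReal.ofReal (phi (x - u) * (h u * γ u) / convPhi γ x) := by
        refine lintegral_congr fun u => ?_
        rw [← ENNReal.ofReal_mul (hp u)]
        ring_nf
    _ = ENNReal.ofReal ((∫ u, phi (x - u) * (h u * γ u)) / convPhi γ x) := by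
        rw [← integral_div, ofReal_integral_eq_lintegral_ofReal (hI.div_const _)]
        exact ae_of_all _ fun u =>
          div_nonneg (mul_nonneg (phi_pos _).le (mul_nonneg (hh u) (hγ u))) hc.le
    _ ≤ ENNReal.ofReal V := ENNReal.ofReal_le_ofReal ((div_le_iff₀ hc).2 hV)

/-! ### The Cauchy slab -/

lemma integrable_slabDensity : Integrable slabDensity := integrable_cauchyPDFReal _

lemma g1_pos (x : ℝ) : 0 < g1 x :=
  (component_bayes measurable_slabDensity slabDensity_pos integral_slabDensity x).1

lemma measurable_g1 : Measurable g1 := measurable_convPhi measurable_slabDensity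

lemma integrable_g1 : Integrable g1 := integrable_convPhi integrable_slabDensity

lemma integral_g1 : ∫ x, g1 x = 1 :=
  (integral_convPhi integrable_slabDensity).trans integral_slabDensity

lemma isProbabilityMeasure_postComponent_slabDensity (x : ℝ) :
    IsProbabilityMeasure (postComponent slabDensity x) :=
  (component_bayes measurable_slabDensity slabDensity_pos integral_slabDensity x).2.1

lemma slabDensity_eq_div (u : ℝ) :
    slabDensity u = 0.05 / Real.pi / (1 + 0.0025 * u ^ 2) := by
  rw [slabDensity_eq]
  norm_num [slabParam, div_eq_mul_inv]

lemma slabDensity_le_mul (u v : ℝ) :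
    slabDensity u ≤ 2 * (1 + 0.0025 * (u - v) ^ 2) * slabDensity v := by
  have hquad : 1 + 0.0025 * v ^ 2 ≤ 2 * (1 + 0.0025 * (u - v) ^ 2) * (1 + 0.0025 * u ^ 2) := by
    nlinarith [sq_nonneg (2 * u - v), mul_nonneg (sq_nonneg (u - v)) (sq_nonneg u)]
  rw [slabDensity_eq_div, slabDensity_eq_div, mul_div_assoc', div_le_div_iff₀ (by positivity)
    (by positivity)]
  calc 0.05 / Real.pi * (1 + 0.0025 * v ^ 2)
      ≤ 0.05 / Real.pi * (2 * (1 + 0.0025 * (u - v) ^ 2) * (1 + 0.0025 * u ^ 2)) := by gcongr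
    _ = _ := by ring

lemma inv_le_slabDensity (x : ℝ) : (100 * (1 + x ^ 2))⁻¹ ≤ slabDensity x := by
  have hpi := Real.pi_pos
  rw [slabDensity_eq_div, div_div, inv_eq_one_div, div_le_div_iff₀ (by positivity) (by positivity)]
  nlinarith [sq_nonneg x, Real.pi_le_four, mul_nonneg hpi.le (sq_nonneg x)]

lemma half_mul_one_sub_le_slabDensity (x u : ℝ) :
    slabDensity x / 2 * (1 - 0.0025 * (u - x) ^ 2) ≤ slabDensity u := by
  have h := slabDensity_le_mul x u
  rw [← neg_sub u x, neg_sq] at h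
  have hu := slabDensity_pos u
  set t : ℝ := 0.0025 * (u - x) ^ 2
  have ht : 0 ≤ t := by positivity
  rcases le_total t 1 with h1 | h1
  · calc slabDensity x / 2 * (1 - t) ≤ (1 + t) * slabDensity u * (1 - t) :=
          mul_le_mul_of_nonneg_right (by linarith) (by linarith)
      _ ≤ slabDensity u := by nlinarith [mul_nonneg ht ht]
  · exact (mul_nonpos_of_nonneg_of_nonpos (half_pos (slabDensity_pos x)).le
      (by linarith)).trans hu.le

lemma slabDensity_le_g1 (x : ℝ) : slabDensity x ≤ 3 * g1 x := by
  have hW := (integrable_sub_sq_gaussianReal x).const_mul 0.0025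
  have h := integral_mono (((integrable_const 1).sub hW).const_mul (slabDensity x / 2))
    (integrable_gaussianReal integrable_slabDensity x) (half_mul_one_sub_le_slabDensity x)
  simp only [Pi.sub_apply] at h
  rw [integral_const_mul, integral_sub (integrable_const 1) hW, integral_const_mul,
    integral_sub_sq_gaussianReal, integral_const, probReal_univ, one_smul,
    ← convPhi_eq_integral] at h
  change _ ≤ g1 x at h
  linarith [slabDensity_pos x]

lemma inv_le_g1 (x : ℝ) : (300 * (1 + x ^ 2))⁻¹ ≤ g1 x := by
  have h := (inv_le_slabDensity x).trans (slabDensity_le_g1 x)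
  rw [inv_le_iff_one_le_mul₀ (by positivity)] at h ⊢
  linarith

lemma sub_sq_mul_slabDensity_le (x u : ℝ) :
    (u - x) ^ 2 * slabDensity u ≤ 8.16 * slabDensity x * Real.exp ((u - x) ^ 2 / 4) := by
  have h2 := sq_le_exp (u - x)
  have h4 := pow_four_le_exp (u - x)
  calc (u - x) ^ 2 * slabDensity u
      ≤ (u - x) ^ 2 * (2 * (1 + 0.0025 * (u - x) ^ 2) * slabDensity x) :=
        mul_le_mul_of_nonneg_left (slabDensity_le_mul u x) (sq_nonneg _)
    _ = (2 * (u - x) ^ 2 + 0.005 * (u - x) ^ 4) * slabDensity x := by ring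
    _ ≤ (8.16 * Real.exp ((u - x) ^ 2 / 4)) * slabDensity x :=
        mul_le_mul_of_nonneg_right (by linarith) (slabDensity_pos x).le
    _ = _ := by ring

lemma lintegral_slab_sub_sq_le (x : ℝ) :
    ∫⁻ u, ENNReal.ofReal ((u - x) ^ 2) ∂(postComponent slabDensity x) ≤ ENNReal.ofReal 37 := by
  have hE := (integrable_exp_sub_sq_gaussianReal x).const_mul (8.16 * slabDensity x)
  have hI : Integrable (fun u => (u - x) ^ 2 * slabDensity u) (gaussianReal x 1) := by
    refine hE.mono' (Measurable.aestronglyMeasurable ?_) (ae_of_all _ fun u => ?_)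
    · exact (by fun_prop : Measurable fun u : ℝ => (u - x) ^ 2).mul measurable_slabDensity
    · rw [Real.norm_of_nonneg (mul_nonneg (sq_nonneg _) (slabDensity_pos u).le)]
      exact sub_sq_mul_slabDensity_le x u
  refine lintegral_postComponent_le (fun u => (slabDensity_pos u).le) (fun u => sq_nonneg _)
    measurable_slabDensity (g1_pos x) hI ?_
  calc ∫ u, (u - x) ^ 2 * slabDensity u ∂gaussianReal x 1
      ≤ 8.16 * slabDensity x * ∫ u, Real.exp ((u - x) ^ 2 / 4) ∂gaussianReal x 1 := by
        rw [← integral_const_mul]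
        exact integral_mono hI hE (sub_sq_mul_slabDensity_le x)
    _ ≤ 8.16 * (3 * g1 x) * (3 / 2) := by
        have := g1_pos x
        gcongr
        · exact slabDensity_le_g1 x
        · exact integral_exp_sub_sq_gaussianReal_le x
    _ ≤ 37 * g1 x := by linarith [g1_pos x]

lemma g1_le_slabDensity (x : ℝ) : g1 x ≤ 3 * slabDensity x := by
  have hW := (integrable_sub_sq_gaussianReal x).const_mul 0.0025
  have h := integral_mono (integrable_gaussianReal integrable_slabDensity x)
    ((((integrable_const 1).add hW).const_mul 2).mul_const (slabDensity x))
    (slabDensity_le_mul · x)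
  simp only [Pi.add_apply] at h
  rw [integral_mul_const, integral_const_mul, integral_add (integrable_const 1) hW,
    integral_const_mul, integral_sub_sq_gaussianReal, integral_const, probReal_univ, one_smul,
    ← convPhi_eq_integral] at h
  change g1 x ≤ _ at h
  linarith [slabDensity_pos x]

/-! ### The Laplace density -/

/-- The density of the Laplace distribution with rate `l`; the spike is the case
`l = spikeParam n`. -/
def laplaceDensity (l u : ℝ) : ℝ := l / 2 * Real.exp (-(l * |u|))

section

variable {l : ℝ}

lemma laplaceDensity_pos (hl : 0 < l) (u : ℝ) : 0 < laplaceDensity l u := by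
  unfold laplaceDensity
  positivity

lemma laplaceDensity_neg (l u : ℝ) : laplaceDensity l (-u) = laplaceDensity l u := by
  rw [laplaceDensity, laplaceDensity, abs_neg]

lemma laplaceDensity_anti (hl : 0 < l) {u v : ℝ} (h : |u| ≤ |v|) :
    laplaceDensity l v ≤ laplaceDensity l u := by
  unfold laplaceDensity
  gcongr

lemma integral_laplaceDensity (hl : 0 < l) : ∫ u, laplaceDensity l u = 1 := by
  have habs := integral_comp_abs (f := fun u => l / 2 * Real.exp (-l * u))
  simp only [laplaceDensity, ← neg_mul]
  rw [habs, integral_const_mul, integral_exp_mul_Ioi (neg_lt_zero.2 hl)]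
  simp only [mul_zero, Real.exp_zero]
  field_simp

lemma integrable_laplaceDensity (hl : 0 < l) : Integrable (laplaceDensity l) :=
  integrable_of_integral_eq_one (integral_laplaceDensity hl)

lemma integral_sq_mul_laplaceDensity (hl : 0 < l) :
    ∫ u, u ^ 2 * laplaceDensity l u = 2 / l ^ 2 := by
  have habs := integral_comp_abs (f := fun u => l / 2 * (u ^ 2 * Real.exp (-(l * u))))
  have hGamma : ∫ u in Set.Ioi (0 : ℝ), u ^ 2 * Real.exp (-(l * u)) = 2 / l ^ 3 := by
    have h := Real.integral_rpow_mul_exp_neg_mul_Ioi (a := 3) (by norm_num) hl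
    norm_num at h
    rw [h]
    field_simp
  calc ∫ u, u ^ 2 * laplaceDensity l u
      = ∫ u, l / 2 * (|u| ^ 2 * Real.exp (-(l * |u|))) := by
        simp only [laplaceDensity, sq_abs, mul_left_comm]
    _ = 2 / l ^ 2 := by
        rw [habs, integral_const_mul, hGamma]
        field_simp

lemma integrable_sq_mul_laplaceDensity (hl : 0 < l) :
    Integrable fun u => u ^ 2 * laplaceDensity l u :=
  .of_integral_ne_zero (by rw [integral_sq_mul_laplaceDensity hl]; positivity)

lemma phi_mul_le_convPhi_laplaceDensity (hl : 0 < l) (x : ℝ) :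
    phi x * (1 - 1 / l ^ 2) ≤ convPhi (laplaceDensity l) x := by
  have h := phi_mul_one_sub_le_convPhi (fun u => (laplaceDensity_pos hl u).le)
    (laplaceDensity_neg l) (integral_laplaceDensity hl) (integrable_sq_mul_laplaceDensity hl) x
  rw [integral_sq_mul_laplaceDensity hl] at h
  convert! h using 3
  ring

/-- Below half the rate, the tilt `exp (x * u)` of the Gaussian factor only halves the rate. -/
lemma phi_sub_mul_laplaceDensity_le (hl : 0 < l) {x : ℝ} (hx : |x| ≤ l / 2) (u : ℝ) :
    phi (x - u) * laplaceDensity l u ≤ 2 * phi x * laplaceDensity (l / 2) u := by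
  have hxu : x * u ≤ l / 2 * |u| :=
    (le_abs_self _).trans ((abs_mul x u).trans_le (mul_le_mul_of_nonneg_right hx (abs_nonneg u)))
  have hexp : Real.exp (x * u - u ^ 2 / 2) * Real.exp (-(l * |u|)) ≤
      Real.exp (-(l / 2 * |u|)) := by
    rw [← Real.exp_add, Real.exp_le_exp]
    linarith [sq_nonneg u]
  calc phi (x - u) * laplaceDensity l u
      = phi x * (l / 2) * (Real.exp (x * u - u ^ 2 / 2) * Real.exp (-(l * |u|))) := by
        rw [phi_sub_eq, laplaceDensity]
        ring
    _ ≤ phi x * (l / 2) * Real.exp (-(l / 2 * |u|)) :=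
        mul_le_mul_of_nonneg_left hexp (mul_pos (phi_pos x) (half_pos hl)).le
    _ = 2 * phi x * laplaceDensity (l / 2) u := by
        rw [laplaceDensity]
        ring

lemma convPhi_laplaceDensity_le (hl : 0 < l) {x : ℝ} (hx : |x| ≤ l / 2) :
    convPhi (laplaceDensity l) x ≤ 2 * phi x := by
  have h := integral_mono (integrable_phi_sub_mul (integrable_laplaceDensity hl) x)
    ((integrable_laplaceDensity (half_pos hl)).const_mul (2 * phi x))
    (phi_sub_mul_laplaceDensity_le hl hx)
  rwa [integral_const_mul, integral_laplaceDensity (half_pos hl), mul_one] at h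

lemma integrable_sq_mul_laplaceDensity_gaussianReal (hl : 0 < l) (x : ℝ) :
    Integrable (fun u => u ^ 2 * laplaceDensity l u) (gaussianReal x 1) :=
  integrable_gaussianReal (integrable_sq_mul_laplaceDensity hl) x

lemma integral_sq_mul_laplaceDensity_le (hl : 0 < l) {x : ℝ} (hx : |x| ≤ l / 2) :
    ∫ u, u ^ 2 * laplaceDensity l u ∂gaussianReal x 1 ≤ 16 / l ^ 2 * phi x := by
  have h := integral_mono (integrable_gaussianReal_iff.1
      (integrable_sq_mul_laplaceDensity_gaussianReal hl x))
    ((integrable_sq_mul_laplaceDensity (half_pos hl)).const_mul (2 * phi x)) fun u => by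
      have := mul_le_mul_of_nonneg_left (phi_sub_mul_laplaceDensity_le hl hx u) (sq_nonneg u)
      linarith
  rw [integral_const_mul, integral_sq_mul_laplaceDensity (half_pos hl),
    ← integral_gaussianReal_eq_integral_phi_mul] at h
  refine h.trans_eq ?_
  field_simp
  norm_num
  rw [mul_comm]

lemma phi_sub_mul_laplaceDensity_le_add (hl : 0 < l) (x u : ℝ) :
    phi (x - u) * laplaceDensity l u ≤ Real.exp (-x ^ 2 / 8) * laplaceDensity l u +
      2 * Real.exp (-(l / 4 * |x|)) * laplaceDensity (l / 2) u := by
  have hγ := laplaceDensity_pos hl u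
  have hγ' := laplaceDensity_pos (half_pos hl) u
  rcases le_total |u| (|x| / 2) with hu | hu
  · have hphi : phi (x - u) ≤ Real.exp (-x ^ 2 / 8) := by
      have hsub : |x| / 2 ≤ |x - u| := by linarith [abs_sub_abs_le_abs_sub x u]
      have hsq : x ^ 2 / 4 ≤ (x - u) ^ 2 := by
        rw [← sq_abs x, ← sq_abs (x - u)]
        nlinarith [abs_nonneg x]
      exact (phi_le_exp _).trans (Real.exp_le_exp.2 (by linarith))
    exact (mul_le_mul_of_nonneg_right hphi hγ.le).trans (le_add_of_nonneg_right (by positivity))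
  · have hexp : Real.exp (-(l * |u|)) ≤
        Real.exp (-(l / 4 * |x|)) * Real.exp (-(l / 2 * |u|)) := by
      rw [← Real.exp_add, Real.exp_le_exp]
      nlinarith
    have htail : laplaceDensity l u ≤
        2 * Real.exp (-(l / 4 * |x|)) * laplaceDensity (l / 2) u := by
      unfold laplaceDensity
      linarith [mul_le_mul_of_nonneg_left hexp (half_pos hl).le]
    calc phi (x - u) * laplaceDensity l u ≤ laplaceDensity l u :=
          mul_le_of_le_one_left hγ.le (phi_le_one _)
      _ ≤ _ := htail.trans (le_add_of_nonneg_left (by positivity))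

lemma convPhi_laplaceDensity_le_exp (hl : 0 < l) (x : ℝ) :
    convPhi (laplaceDensity l) x ≤
      Real.exp (-x ^ 2 / 8) + 2 * Real.exp (-(l / 4 * |x|)) := by
  have hI := integrable_laplaceDensity hl
  have hI' := integrable_laplaceDensity (half_pos hl)
  have h := integral_mono (integrable_phi_sub_mul hI x)
    ((hI.const_mul (Real.exp (-x ^ 2 / 8))).add
      (hI'.const_mul (2 * Real.exp (-(l / 4 * |x|))))) (phi_sub_mul_laplaceDensity_le_add hl x)
  simp only [Pi.add_apply] at h
  rwa [integral_add (hI.const_mul _) (hI'.const_mul _), integral_const_mul, integral_const_mul,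
    integral_laplaceDensity hl, integral_laplaceDensity (half_pos hl), mul_one, mul_one] at h

end

/-! ### The Laplace spike -/

section

variable {n : ℕ}

lemma twelve_mul_le_spikeParam (n : ℕ) : 12 * (n : ℝ) ≤ spikeParam n := by
  have h : (2.4 : ℝ) ≤ √(2 * Real.pi) :=
    Real.le_sqrt_of_sq_le (by norm_num; linarith [Real.pi_gt_three])
  exact mul_le_mul_of_nonneg_right (by linarith) n.cast_nonneg

lemma g0_pos (hn : 0 < n) (x : ℝ) : 0 < g0 n x :=
  (component_bayes (measurable_spikeDensity n) (spikeDensity_pos hn) (integral_spikeDensity hn) x).1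

lemma measurable_g0 (n : ℕ) : Measurable (g0 n) := measurable_convPhi (measurable_spikeDensity n)

lemma isProbabilityMeasure_postComponent_spikeDensity (hn : 0 < n) (x : ℝ) :
    IsProbabilityMeasure (postComponent (spikeDensity n) x) :=
  (component_bayes (measurable_spikeDensity n) (spikeDensity_pos hn)
    (integral_spikeDensity hn) x).2.1

lemma phi_le_mul_g0 (hn : 0 < n) (x : ℝ) : phi x ≤ (1 + 1 / (n : ℝ) ^ 2) * g0 n x := by
  have hn1 : (1 : ℝ) ≤ n := by exact_mod_cast hn
  have h : phi x * (1 - 1 / spikeParam n ^ 2) ≤ g0 n x :=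
    phi_mul_le_convPhi_laplaceDensity (spikeParam_pos hn) x
  set t : ℝ := 1 / (n : ℝ) ^ 2
  have ht0 : 0 < t := by positivity
  have ht1 : t ≤ 1 := div_le_one_of_le₀ (one_le_pow₀ hn1) (by positivity)
  have hl : 1 / spikeParam n ^ 2 ≤ t / 144 := by
    rw [div_div, one_div_le_one_div (pow_pos (spikeParam_pos hn) 2) (by positivity)]
    nlinarith [twelve_mul_le_spikeParam n]
  have hfac : 1 ≤ (1 + t) * (1 - t / 144) := by nlinarith
  calc phi x ≤ phi x * ((1 + t) * (1 - t / 144)) := le_mul_of_one_le_right (phi_pos x).le hfac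
    _ = (1 + t) * (phi x * (1 - t / 144)) := by ring
    _ ≤ (1 + t) * (phi x * (1 - 1 / spikeParam n ^ 2)) := by
        have := phi_pos x
        gcongr
    _ ≤ (1 + t) * g0 n x := by gcongr

lemma phi_le_two_mul_g0 (hn : 0 < n) (x : ℝ) : phi x ≤ 2 * g0 n x := by
  have hn1 : (1 : ℝ) ≤ n := by exact_mod_cast hn
  have ht1 : 1 / (n : ℝ) ^ 2 ≤ 1 := div_le_one_of_le₀ (one_le_pow₀ hn1) (by positivity)
  exact (phi_le_mul_g0 hn x).trans
    (mul_le_mul_of_nonneg_right (by linarith) (g0_pos hn x).le)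

lemma g0_le_two_mul_phi (hn : 0 < n) {x : ℝ} (hx : |x| ≤ spikeParam n / 2) :
    g0 n x ≤ 2 * phi x :=
  convPhi_laplaceDensity_le (spikeParam_pos hn) hx

lemma g0_le_exp (hn : 0 < n) (x : ℝ) :
    g0 n x ≤ Real.exp (-x ^ 2 / 8) + 2 * Real.exp (-(3 * n * |x|)) := by
  have h : g0 n x ≤ _ := convPhi_laplaceDensity_le_exp (spikeParam_pos hn) x
  have hrate : 3 * n * |x| ≤ spikeParam n / 4 * |x| :=
    mul_le_mul_of_nonneg_right (by linarith [twelve_mul_le_spikeParam n]) (abs_nonneg x)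
  have := Real.exp_le_exp.2 (neg_le_neg hrate)
  linarith

lemma lintegral_spike_sq_le_of_integral_le (hn : 0 < n) {x V : ℝ}
    (hV : ∫ u, u ^ 2 * spikeDensity n u ∂gaussianReal x 1 ≤ V * g0 n x) :
    ∫⁻ u, ENNReal.ofReal (u ^ 2) ∂(postComponent (spikeDensity n) x) ≤ ENNReal.ofReal V :=
  lintegral_postComponent_le (fun u => (spikeDensity_pos hn u).le) sq_nonneg
    (measurable_spikeDensity n) (g0_pos hn x)
    (integrable_sq_mul_laplaceDensity_gaussianReal (spikeParam_pos hn) x) hV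

lemma lintegral_spike_sq_le (hn : 0 < n) (x : ℝ) :
    ∫⁻ u, ENNReal.ofReal (u ^ 2) ∂(postComponent (spikeDensity n) x) ≤
      ENNReal.ofReal (x ^ 2 + 1) := by
  have hl := spikeParam_pos hn
  exact lintegral_spike_sq_le_of_integral_le hn (integral_sq_mul_le_of_antitone
    (fun _ _ h => laplaceDensity_anti hl h)
    (integrable_gaussianReal (integrable_laplaceDensity hl) x)
    (integrable_sq_mul_laplaceDensity_gaussianReal hl x))

lemma lintegral_spike_sq_le_div (hn : 0 < n) (x : ℝ) :
    ∫⁻ u, ENNReal.ofReal (u ^ 2) ∂(postComponent (spikeDensity n) x) ≤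
      ENNReal.ofReal ((1 + x ^ 4) / (n : ℝ) ^ 2) := by
  have hn0 : (0 : ℝ) < n := by exact_mod_cast hn
  have hl := spikeParam_pos hn
  have hl12 := twelve_mul_le_spikeParam n
  rcases le_total |x| (spikeParam n / 2) with hx | hx
  · refine lintegral_spike_sq_le_of_integral_le hn ?_
    have hrate : 16 / spikeParam n ^ 2 ≤ 1 / 2 * (1 / (n : ℝ) ^ 2) := by
      rw [div_mul_div_comm, div_le_div_iff₀ (by positivity) (by positivity)]
      nlinarith
    calc ∫ u, u ^ 2 * spikeDensity n u ∂gaussianReal x 1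
        ≤ 16 / spikeParam n ^ 2 * phi x := integral_sq_mul_laplaceDensity_le hl hx
      _ ≤ 1 / 2 * (1 / (n : ℝ) ^ 2) * (2 * g0 n x) :=
          mul_le_mul hrate (phi_le_two_mul_g0 hn x) (phi_pos x).le (by positivity)
      _ = 1 / (n : ℝ) ^ 2 * g0 n x := by ring
      _ ≤ (1 + x ^ 4) / (n : ℝ) ^ 2 * g0 n x := by
          have := g0_pos hn x
          gcongr
          exact le_add_of_nonneg_right (by positivity)
  · refine (lintegral_spike_sq_le hn x).trans (ENNReal.ofReal_le_ofReal ?_)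
    have hx2 : 36 * (n : ℝ) ^ 2 ≤ x ^ 2 := by
      rw [← sq_abs x]
      nlinarith
    rw [le_div_iff₀ (by positivity)]
    nlinarith [mul_le_mul_of_nonneg_left hx2 (sq_nonneg x), sq_nonneg (x ^ 2 - 1)]

end

/-! ### The posterior risk of a coordinate -/

section

variable {n : ℕ} {α : ℝ}

/-- The marginal density `(1 - α) g₀ + α g₁` of one observation under the prior. -/
def marginal (n : ℕ) (α x : ℝ) : ℝ := (1 - α) * g0 n x + α * g1 x

lemma marginal_pos (hn : 0 < n) (hα : α ∈ Set.Icc (0 : ℝ) 1) (x : ℝ) : 0 < marginal n α x :=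
  (coord_bayes hn hα x).1

lemma mul_g1_le_marginal (hn : 0 < n) (hα : α ≤ 1) (x : ℝ) : α * g1 x ≤ marginal n α x :=
  le_add_of_nonneg_left (mul_nonneg (sub_nonneg.2 hα) (g0_pos hn x).le)

lemma half_g0_le_marginal (hn : 0 < n) (hα0 : 0 ≤ α) (hα2 : α ≤ 1 / 2) (x : ℝ) :
    g0 n x / 2 ≤ marginal n α x := by
  unfold marginal
  nlinarith [g0_pos hn x, mul_nonneg hα0 (g1_pos x).le]

lemma postWeight_eq_div_marginal (n : ℕ) (α x : ℝ) :
    postWeight n α x = α * g1 x / marginal n α x :=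
  rfl

lemma postWeight_nonneg (hn : 0 < n) (hα : α ∈ Set.Icc (0 : ℝ) 1) (x : ℝ) :
    0 ≤ postWeight n α x :=
  div_nonneg (mul_nonneg hα.1 (g1_pos x).le) (marginal_pos hn hα x).le

lemma postWeight_le_one (hn : 0 < n) (hα : α ∈ Set.Icc (0 : ℝ) 1) (x : ℝ) :
    postWeight n α x ≤ 1 :=
  div_le_one_of_le₀ (mul_g1_le_marginal hn hα.2 x) (marginal_pos hn hα x).le

lemma one_sub_postWeight (hn : 0 < n) (hα : α ∈ Set.Icc (0 : ℝ) 1) (x : ℝ) :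
    1 - postWeight n α x = (1 - α) * g0 n x / marginal n α x := by
  rw [postWeight_eq_div_marginal, one_sub_div (marginal_pos hn hα x).ne', marginal,
    add_sub_cancel_right]

lemma postWeight_mono (hn : 0 < n) {α' : ℝ} (hα : α ∈ Set.Icc (0 : ℝ) 1)
    (hα' : α' ∈ Set.Icc (0 : ℝ) 1) (h : α ≤ α') (x : ℝ) :
    postWeight n α x ≤ postWeight n α' x := by
  rw [postWeight_eq_div_marginal, postWeight_eq_div_marginal,
    div_le_div_iff₀ (marginal_pos hn hα x) (marginal_pos hn hα' x), marginal, marginal]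
  nlinarith [mul_nonneg (sub_nonneg.2 h) (mul_pos (g0_pos hn x) (g1_pos x)).le]

lemma lintegral_sub_sq_le_of_prob {ν : Measure ℝ} [IsProbabilityMeasure ν] {b V : ℝ} (hV : 0 ≤ V)
    (h : ∫⁻ u, ENNReal.ofReal ((u - b) ^ 2) ∂ν ≤ ENNReal.ofReal V) (c : ℝ) :
    ∫⁻ u, ENNReal.ofReal ((u - c) ^ 2) ∂ν ≤ ENNReal.ofReal (2 * V + 2 * (b - c) ^ 2) := by
  calc ∫⁻ u, ENNReal.ofReal ((u - c) ^ 2) ∂ν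
      ≤ ∫⁻ u, (ENNReal.ofReal 2 * ENNReal.ofReal ((u - b) ^ 2) +
          ENNReal.ofReal (2 * (b - c) ^ 2)) ∂ν := by
        refine lintegral_mono fun u => ?_
        rw [← ENNReal.ofReal_mul (by norm_num), ← ENNReal.ofReal_add (by positivity)
          (by positivity)]
        refine ENNReal.ofReal_le_ofReal ?_
        nlinarith [sq_nonneg (u - b - (b - c))]
    _ = ENNReal.ofReal 2 * ∫⁻ u, ENNReal.ofReal ((u - b) ^ 2) ∂ν +
          ENNReal.ofReal (2 * (b - c) ^ 2) := by
        rw [lintegral_add_right _ measurable_const,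
          lintegral_const_mul' _ _ ENNReal.ofReal_ne_top, lintegral_const, measure_univ, mul_one]
    _ ≤ ENNReal.ofReal 2 * ENNReal.ofReal V + ENNReal.ofReal (2 * (b - c) ^ 2) := by gcongr
    _ = _ := by
        rw [← ENNReal.ofReal_mul (by norm_num), ← ENNReal.ofReal_add (by positivity)
          (by positivity)]

/-- The posterior risk `∫ (u - μ)² dΠ_α(u | x)` of a coordinate with true value `μ` and
observation `x`. -/
def coordRisk (n : ℕ) (α x μ : ℝ) : ℝ≥0∞ :=
  ∫⁻ u, ENNReal.ofReal ((u - μ) ^ 2) ∂(coordPosterior n α x)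

lemma coordRisk_le (hn : 0 < n) (hα : α ∈ Set.Icc (0 : ℝ) 1) {x μ V : ℝ} (hV : 0 ≤ V)
    (h : ∫⁻ u, ENNReal.ofReal ((u - μ) ^ 2) ∂(postComponent (spikeDensity n) x) ≤
      ENNReal.ofReal V) :
    coordRisk n α x μ ≤ ENNReal.ofReal ((1 - postWeight n α x) * V +
      postWeight n α x * (74 + 2 * (x - μ) ^ 2)) := by
  have := isProbabilityMeasure_postComponent_slabDensity x
  have hslab := lintegral_sub_sq_le_of_prob (by norm_num) (lintegral_slab_sub_sq_le x) μ
  norm_num at hslab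
  have ha := postWeight_nonneg hn hα x
  have ha' := sub_nonneg.2 (postWeight_le_one hn hα x)
  rw [coordRisk, coordPosterior, lintegral_add_measure, lintegral_smul_measure,
    lintegral_smul_measure, ENNReal.ofReal_add (by positivity) (by positivity),
    ENNReal.ofReal_mul ha, ENNReal.ofReal_mul ha', smul_eq_mul, smul_eq_mul]
  gcongr

lemma coordRisk_zero_le (hn : 0 < n) (hα : α ∈ Set.Icc (0 : ℝ) 1) (x : ℝ) :
    coordRisk n α x 0 ≤ ENNReal.ofReal ((1 + x ^ 4) / (n : ℝ) ^ 2 +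
      postWeight n α x * (74 + 2 * x ^ 2)) := by
  have hV : 0 ≤ (1 + x ^ 4) / (n : ℝ) ^ 2 := by positivity
  have h := coordRisk_le hn hα (μ := 0) hV (by simpa using lintegral_spike_sq_le_div hn x)
  rw [sub_zero] at h
  refine h.trans (ENNReal.ofReal_le_ofReal (add_le_add_left ?_ _))
  exact mul_le_of_le_one_left hV (sub_le_self 1 (postWeight_nonneg hn hα x))

lemma nat_mul_exp_neg_sq_mul_le {x : ℝ} (hn : 0 < n) (hx : 16 * Real.log n ≤ x ^ 2) :
    n * Real.exp (-x ^ 2 / 8) * ((1 + x ^ 2) * x ^ 2) ≤ 528 := by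
  have hnexp : (n : ℝ) ≤ Real.exp (x ^ 2 / 16) := by
    rw [← Real.log_le_iff_le_exp (by exact_mod_cast hn)]
    linarith
  have hpoly : (1 + x ^ 2) * x ^ 2 ≤ 528 * Real.exp (x ^ 2 / 16) := by
    have h1 := Real.pow_div_factorial_le_exp (x ^ 2 / 16) (by positivity) 1
    have h2 := Real.pow_div_factorial_le_exp (x ^ 2 / 16) (by positivity) 2
    norm_num [Nat.factorial] at h1 h2
    linarith
  calc n * Real.exp (-x ^ 2 / 8) * ((1 + x ^ 2) * x ^ 2)
      ≤ Real.exp (x ^ 2 / 16) * Real.exp (-x ^ 2 / 8) * (528 * Real.exp (x ^ 2 / 16)) := by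
        gcongr
    _ = 528 * Real.exp (x ^ 2 / 16 + -x ^ 2 / 8 + x ^ 2 / 16) := by
        rw [Real.exp_add, Real.exp_add]
        ring
    _ = 528 := by
        ring_nf
        norm_num

lemma nat_mul_exp_neg_abs_mul_le {x : ℝ} (hn : 0 < n) (hx : 1 ≤ |x|) :
    n * Real.exp (-(3 * n * |x|)) * ((1 + x ^ 2) * x ^ 2) ≤ 26 := by
  have hn1 : (1 : ℝ) ≤ n := by exact_mod_cast hn
  have hnexp : (n : ℝ) ≤ Real.exp n := (le_add_of_nonneg_right zero_le_one).trans
    (Real.add_one_le_exp _)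
  have hpoly : (1 + x ^ 2) * x ^ 2 ≤ 26 * Real.exp |x| := by
    have h2 := Real.pow_div_factorial_le_exp |x| (abs_nonneg x) 2
    have h4 := Real.pow_div_factorial_le_exp |x| (abs_nonneg x) 4
    norm_num [Nat.factorial, Even.pow_abs] at h2 h4
    linarith
  calc n * Real.exp (-(3 * n * |x|)) * ((1 + x ^ 2) * x ^ 2)
      ≤ Real.exp n * Real.exp (-(3 * n * |x|)) * (26 * Real.exp |x|) := by gcongr
    _ = 26 * Real.exp (n + -(3 * n * |x|) + |x|) := by
        rw [Real.exp_add, Real.exp_add]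
        ring
    _ ≤ 26 * 1 := by
        gcongr
        rw [Real.exp_le_one_iff]
        nlinarith
    _ = 26 := mul_one _

lemma nat_mul_g0_mul_le (hn : 0 < n) {x : ℝ} (hx1 : 1 ≤ |x|) (hx : 16 * Real.log n ≤ x ^ 2) :
    n * g0 n x * ((1 + x ^ 2) * x ^ 2) ≤ 580 := by
  have hG := nat_mul_exp_neg_sq_mul_le hn hx
  have hL := nat_mul_exp_neg_abs_mul_le hn hx1
  calc n * g0 n x * ((1 + x ^ 2) * x ^ 2)
      ≤ n * (Real.exp (-x ^ 2 / 8) + 2 * Real.exp (-(3 * n * |x|))) * ((1 + x ^ 2) * x ^ 2) := by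
        gcongr
        exact g0_le_exp hn x
    _ ≤ 580 := by linarith

lemma one_sub_postWeight_le (hn : 0 < n) (h0 : 1 / (n : ℝ) ≤ α) (h1 : α ≤ 1) (x : ℝ) :
    1 - postWeight n α x ≤ n * g0 n x * (300 * (1 + x ^ 2)) := by
  have hn0 : (0 : ℝ) < n := by exact_mod_cast hn
  have hα0 : 0 < α := (by positivity : (0 : ℝ) < 1 / n).trans_le h0
  have hα : α ∈ Set.Icc (0 : ℝ) 1 := ⟨hα0.le, h1⟩
  have hg0 := g0_pos hn x
  have hnα : 1 ≤ n * α := (div_le_iff₀' hn0).1 h0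
  have hg1 : 1 ≤ g1 x * (300 * (1 + x ^ 2)) :=
    (inv_le_iff_one_le_mul₀ (by positivity)).1 (inv_le_g1 x)
  rw [one_sub_postWeight hn hα, div_le_iff₀ (marginal_pos hn hα x)]
  calc (1 - α) * g0 n x ≤ g0 n x * (1 * 1) := by nlinarith
    _ ≤ g0 n x * (n * α * (g1 x * (300 * (1 + x ^ 2)))) := by gcongr
    _ = n * g0 n x * (300 * (1 + x ^ 2)) * (α * g1 x) := by ring
    _ ≤ n * g0 n x * (300 * (1 + x ^ 2)) * marginal n α x := by
        gcongr
        exact mul_g1_le_marginal hn h1 x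

lemma one_sub_postWeight_mul_sq_le (hn : 0 < n) (hL : 1 ≤ Real.log n) (h0 : 1 / (n : ℝ) ≤ α)
    (h1 : α ≤ 1) (x : ℝ) :
    (1 - postWeight n α x) * x ^ 2 ≤ 174000 * Real.log n := by
  have hα : α ∈ Set.Icc (0 : ℝ) 1 := ⟨(by positivity : (0 : ℝ) ≤ 1 / n).trans h0, h1⟩
  rcases le_total (x ^ 2) (16 * Real.log n) with hx | hx
  · nlinarith [postWeight_nonneg hn hα x, sq_nonneg x]
  · have hx1 : 1 ≤ |x| := by
      rw [← one_le_sq_iff_one_le_abs]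
      linarith
    calc (1 - postWeight n α x) * x ^ 2
        ≤ n * g0 n x * (300 * (1 + x ^ 2)) * x ^ 2 := by
          gcongr
          exact one_sub_postWeight_le hn h0 h1 x
      _ = 300 * (n * g0 n x * ((1 + x ^ 2) * x ^ 2)) := by ring
      _ ≤ 174000 * Real.log n := by linarith [nat_mul_g0_mul_le hn hx1 hx]

lemma coordRisk_signal_le (hn : 0 < n) (hL : 1 ≤ Real.log n) (h0 : 1 / (n : ℝ) ≤ α)
    (h1 : α ≤ 1) (x μ : ℝ) :
    coordRisk n α x μ ≤ ENNReal.ofReal (1100000 * Real.log n + 4 * (x - μ) ^ 2) := by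
  have hα : α ∈ Set.Icc (0 : ℝ) 1 := ⟨(by positivity : (0 : ℝ) ≤ 1 / n).trans h0, h1⟩
  have := isProbabilityMeasure_postComponent_spikeDensity hn x
  have hspike := lintegral_sub_sq_le_of_prob (ν := postComponent (spikeDensity n) x) (b := 0)
    (V := x ^ 2 + 1) (by positivity) (by simpa using lintegral_spike_sq_le hn x) μ
  refine (coordRisk_le hn hα (by positivity) hspike).trans (ENNReal.ofReal_le_ofReal ?_)
  have ha := postWeight_nonneg hn hα x
  have ha' := postWeight_le_one hn hα x
  have hμ : (0 - μ) ^ 2 ≤ 2 * x ^ 2 + 2 * (x - μ) ^ 2 := by nlinarith [sq_nonneg (2 * x - μ)]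
  calc (1 - postWeight n α x) * (2 * (x ^ 2 + 1) + 2 * (0 - μ) ^ 2) +
        postWeight n α x * (74 + 2 * (x - μ) ^ 2)
      ≤ (1 - postWeight n α x) * (6 * x ^ 2 + (74 + 4 * (x - μ) ^ 2)) +
        postWeight n α x * (74 + 4 * (x - μ) ^ 2) := by
        refine add_le_add (mul_le_mul_of_nonneg_left ?_ (sub_nonneg.2 ha'))
          (mul_le_mul_of_nonneg_left ?_ ha) <;> linarith [sq_nonneg (x - μ)]
    _ = 6 * ((1 - postWeight n α x) * x ^ 2) + 74 + 4 * (x - μ) ^ 2 := by ring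
    _ ≤ 1100000 * Real.log n + 4 * (x - μ) ^ 2 := by
        linarith [one_sub_postWeight_mul_sq_le hn hL h0 h1 x]

end

/-! ### The posterior weight of a null coordinate -/

section

variable {n : ℕ} {α T : ℝ}

lemma measurable_postWeight (n : ℕ) (α : ℝ) : Measurable (postWeight n α) :=
  (measurable_g1.const_mul α).div
    (((measurable_g0 n).const_mul _).add (measurable_g1.const_mul _))

lemma integrable_indicator_Icc_const (a b c : ℝ) :
    Integrable ((Set.Icc a b).indicator fun _ : ℝ => c) :=
  (integrable_indicator_iff measurableSet_Icc).2 (integrableOn_const (by simp) enorm_ne_top)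

lemma integral_indicator_Icc_const {a b : ℝ} (hab : a ≤ b) (c : ℝ) :
    ∫ x, (Set.Icc a b).indicator (fun _ : ℝ => c) x = (b - a) * c := by
  rw [integral_indicator_const c measurableSet_Icc, Real.volume_real_Icc_of_le hab, smul_eq_mul]

lemma g1_mul_le (x : ℝ) : g1 x * (74 + 2 * x ^ 2) ≤ 42 := by
  have hpi3 := Real.pi_gt_three
  have h : slabDensity x * (74 + 2 * x ^ 2) ≤ 14 := by
    rw [slabDensity_eq_div, div_div, div_mul_eq_mul_div, div_le_iff₀ (by positivity)]
    nlinarith [sq_nonneg x, mul_nonneg (sub_nonneg.2 hpi3.le) (sq_nonneg x)]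
  calc g1 x * (74 + 2 * x ^ 2) ≤ 3 * slabDensity x * (74 + 2 * x ^ 2) := by
        gcongr
        exact g1_le_slabDensity x
    _ ≤ 42 := by linarith

lemma phi_mul_postWeight_le (hn : 0 < n) (hα0 : 0 ≤ α) (hα2 : α ≤ 1 / 2) (x : ℝ) :
    phi x * postWeight n α x ≤ 4 * α * g1 x := by
  have hα : α ∈ Set.Icc (0 : ℝ) 1 := ⟨hα0, by linarith⟩
  have hphi : phi x ≤ 4 * marginal n α x := by
    linarith [half_g0_le_marginal hn hα0 hα2 x, phi_le_two_mul_g0 hn x]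
  rw [postWeight_eq_div_marginal, mul_div_assoc', div_le_iff₀ (marginal_pos hn hα x)]
  linarith [mul_le_mul_of_nonneg_right hphi (mul_nonneg hα0 (g1_pos x).le)]

lemma phi_mul_postWeight_mul_le (hn : 0 < n) (hα0 : 0 ≤ α) (hα2 : α ≤ 1 / 2) (x : ℝ) :
    phi x * (postWeight n α x * (74 + 2 * x ^ 2)) ≤ 168 * α :=
  calc phi x * (postWeight n α x * (74 + 2 * x ^ 2))
      = phi x * postWeight n α x * (74 + 2 * x ^ 2) := by ring
    _ ≤ 4 * α * g1 x * (74 + 2 * x ^ 2) :=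
        mul_le_mul_of_nonneg_right (phi_mul_postWeight_le hn hα0 hα2 x) (by positivity)
    _ = 4 * α * (g1 x * (74 + 2 * x ^ 2)) := by ring
    _ ≤ 4 * α * 42 := by
        gcongr
        exact g1_mul_le x
    _ = 168 * α := by ring

lemma postWeight_mul_le_exp (hn : 0 < n) (hα : α ∈ Set.Icc (0 : ℝ) 1) {x : ℝ}
    (hx : 8 * Real.log n ≤ x ^ 2) :
    postWeight n α x * (74 + 2 * x ^ 2) ≤ 90 / n * Real.exp (x ^ 2 / 4) := by
  have hn0 : (0 : ℝ) < n := by exact_mod_cast hn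
  have hnexp : (n : ℝ) ≤ Real.exp (x ^ 2 / 8) := by
    rw [← Real.log_le_iff_le_exp hn0]
    linarith
  have hpoly : 74 + 2 * x ^ 2 ≤ 90 * Real.exp (x ^ 2 / 8) := by
    linarith [Real.add_one_le_exp (x ^ 2 / 8), Real.one_le_exp (by positivity : 0 ≤ x ^ 2 / 8)]
  rw [div_mul_eq_mul_div, le_div_iff₀ hn0]
  calc postWeight n α x * (74 + 2 * x ^ 2) * n
      ≤ 1 * (90 * Real.exp (x ^ 2 / 8)) * Real.exp (x ^ 2 / 8) := by
        gcongr
        exact postWeight_le_one hn hα x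
    _ = 90 * Real.exp (x ^ 2 / 8 + x ^ 2 / 8) := by
        rw [Real.exp_add]
        ring
    _ = 90 * Real.exp (x ^ 2 / 4) := by ring_nf

lemma sq_le_sq_of_notMem_Icc (hT : 0 ≤ T) {x : ℝ} (hx : x ∉ Set.Icc (-T) T) : T ^ 2 ≤ x ^ 2 := by
  rw [Set.mem_Icc, ← abs_le, not_le] at hx
  exact sq_le_sq.2 ((abs_of_nonneg hT).trans_le hx.le)

lemma lintegral_postWeight_mul_le (hn : 0 < n) (hα0 : 0 ≤ α) (hα2 : α ≤ 1 / 2)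
    (hT : 0 ≤ T) (hT2 : 8 * Real.log n ≤ T ^ 2) :
    ∫⁻ x, ENNReal.ofReal (postWeight n α x * (74 + 2 * x ^ 2)) ∂(gaussianReal 0 1) ≤
      ENNReal.ofReal (336 * α * T + 135 / n) := by
  have hα : α ∈ Set.Icc (0 : ℝ) 1 := ⟨hα0, by linarith⟩
  have hin := integrable_indicator_Icc_const (-T) T (168 * α)
  have hout := integrable_phi_mul_exp.const_mul (90 / (n : ℝ))
  refine lintegral_gaussian_le (fun x => mul_nonneg (postWeight_nonneg hn hα x) (by positivity))
    (H := fun x => (Set.Icc (-T) T).indicator (fun _ => 168 * α) x +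
      90 / (n : ℝ) * (phi x * Real.exp (x ^ 2 / 4))) (fun x => ?_) (hin.add hout) ?_
  · have hphi := phi_pos x
    by_cases hx : x ∈ Set.Icc (-T) T
    · rw [Set.indicator_of_mem hx]
      exact (phi_mul_postWeight_mul_le hn hα0 hα2 x).trans (le_add_of_nonneg_right (by positivity))
    · rw [Set.indicator_of_notMem hx, zero_add]
      have hlog := hT2.trans (sq_le_sq_of_notMem_Icc hT hx)
      linarith [mul_le_mul_of_nonneg_left (postWeight_mul_le_exp hn hα hlog) hphi.le]
  · have htail : 90 / (n : ℝ) * ∫ x, phi x * Real.exp (x ^ 2 / 4) ≤ 90 / n * (3 / 2) := by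
      gcongr
      exact integral_phi_mul_exp_le
    rw [integral_add hin hout, integral_indicator_Icc_const (by linarith), integral_const_mul]
    refine (add_le_add_right htail _).trans_eq ?_
    ring

end

/-! ### The score of the marginal likelihood -/

section

variable {n : ℕ} {α T : ℝ}

/-- The contribution `(g₁ - g₀) / ((1 - α) g₀ + α g₁)` of an observation to the derivative in `α`
of the log-marginal likelihood. -/
def score (n : ℕ) (α x : ℝ) : ℝ := (g1 x - g0 n x) / marginal n α x

lemma measurable_score (n : ℕ) (α : ℝ) : Measurable (score n α) :=
  (measurable_g1.sub (measurable_g0 n)).div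
    (((measurable_g0 n).const_mul _).add (measurable_g1.const_mul _))

lemma score_le_inv (hn : 0 < n) (hα0 : 0 < α) (hα1 : α ≤ 1) (x : ℝ) : score n α x ≤ 1 / α := by
  rw [score, div_le_div_iff₀ (marginal_pos hn ⟨hα0.le, hα1⟩ x) hα0]
  linarith [mul_g1_le_marginal hn hα1 x, mul_pos hα0 (g0_pos hn x)]

lemma neg_two_le_score (hn : 0 < n) (hα0 : 0 ≤ α) (hα2 : α ≤ 1 / 2) (x : ℝ) :
    -2 ≤ score n α x := by
  rw [score, le_div_iff₀ (marginal_pos hn ⟨hα0, by linarith⟩ x)]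
  linarith [half_g0_le_marginal hn hα0 hα2 x, g1_pos x]

lemma score_le_ratio (hn : 0 < n) (hα : α ∈ Set.Icc (0 : ℝ) 1) (x : ℝ) :
    score n α x ≤ g1 x / g0 n x - 1 := by
  have h0 := g0_pos hn x
  rw [score, div_sub_one h0.ne', div_le_div_iff₀ (marginal_pos hn hα x) h0, marginal]
  nlinarith [mul_nonneg hα.1 (sq_nonneg (g1 x - g0 n x))]

lemma score_le_of_dominant (hn : 0 < n) (hα0 : 0 ≤ α) (hα2 : α ≤ 1 / 2) {x : ℝ}
    (h : g0 n x ≤ α * (g1 x - g0 n x)) :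
    score n α x ≤ g1 x / g0 n x - 1 - g1 x / (4 * g0 n x) := by
  have h0 := g0_pos hn x
  have hratio : 3 * g0 n x ≤ g1 x := by nlinarith [g1_pos x]
  have hmarginal : 2 * g0 n x ≤ marginal n α x := by
    unfold marginal
    linarith
  calc score n α x ≤ (g1 x - g0 n x) / (2 * g0 n x) :=
        div_le_div_of_nonneg_left (by linarith) (by positivity) hmarginal
    _ ≤ (3 * g1 x - 4 * g0 n x) / (4 * g0 n x) := by
        rw [div_le_div_iff₀ (by positivity) (by positivity)]
        nlinarith
    _ = g1 x / g0 n x - 1 - g1 x / (4 * g0 n x) := by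
        field_simp
        ring

lemma sq_score_le (hn : 0 < n) (hα0 : 0 < α) (hα2 : α ≤ 1 / 2) (x : ℝ) :
    score n α x ^ 2 ≤ 4 + 2 / α * (g1 x / g0 n x) := by
  have h0 := g0_pos hn x
  have h1 := g1_pos x
  have hratio : 0 ≤ 2 / α * (g1 x / g0 n x) := by positivity
  rcases le_total (score n α x) 0 with h | h
  · nlinarith [neg_two_le_score hn hα0.le hα2 x]
  · have hle : score n α x ≤ 2 * (g1 x / g0 n x) :=
      calc score n α x ≤ g1 x / (g0 n x / 2) :=
            div_le_div₀ h1.le (by linarith) (by positivity) (half_g0_le_marginal hn hα0.le hα2 x)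
        _ = 2 * (g1 x / g0 n x) := by field_simp
    calc score n α x ^ 2 = score n α x * score n α x := sq _
      _ ≤ 1 / α * (2 * (g1 x / g0 n x)) :=
          mul_le_mul (score_le_inv hn hα0 (by linarith) x) hle h (by positivity)
      _ = 2 / α * (g1 x / g0 n x) := by ring
      _ ≤ 4 + 2 / α * (g1 x / g0 n x) := by linarith

lemma g0_le_two_div_pow_four (hn : 0 < n) {x : ℝ} (hx : |x| ≤ 2 * n)
    (hlog : 8 * Real.log n ≤ x ^ 2) : g0 n x ≤ 2 / (n : ℝ) ^ 4 := by
  have hn0 : (0 : ℝ) < n := by exact_mod_cast hn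
  have hpow : (n : ℝ) ^ 4 ≤ Real.exp (x ^ 2 / 2) := by
    rw [← Real.log_le_iff_le_exp (by positivity), Real.log_pow]
    push_cast
    linarith
  have hphi : phi x ≤ 1 / (n : ℝ) ^ 4 := by
    refine (phi_le_exp x).trans ?_
    rw [neg_div, Real.exp_neg, ← one_div]
    exact one_div_le_one_div_of_le (by positivity) hpow
  calc g0 n x ≤ 2 * phi x :=
        g0_le_two_mul_phi hn (by linarith [twelve_mul_le_spikeParam n])
    _ ≤ 2 * (1 / (n : ℝ) ^ 4) := by gcongr
    _ = 2 / (n : ℝ) ^ 4 := by ring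

lemma one_div_le_g1_of_le {x : ℝ} (hT : 1 ≤ T) (hx : |x| ≤ 2 * T) : 1 / (1500 * T ^ 2) ≤ g1 x := by
  refine le_trans ?_ (inv_le_g1 x)
  rw [← one_div]
  refine one_div_le_one_div_of_le (by positivity) ?_
  nlinarith [sq_abs x, abs_nonneg x]

lemma g0_le_mul_sub_of_mem_Icc (hn : 0 < n) (h0 : 1 / (n : ℝ) ≤ α) {x : ℝ} (hT : 1 ≤ T)
    (hT2 : 8 * Real.log n ≤ T ^ 2) (hTn : 24000 * T ≤ n) (hx : x ∈ Set.Icc T (2 * T)) :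
    g0 n x ≤ α * (g1 x - g0 n x) := by
  have hn1 : (1 : ℝ) ≤ n := by exact_mod_cast hn
  have hn0 : (0 : ℝ) < n := by linarith
  obtain ⟨hTx, hx2⟩ := hx
  have habs : |x| = x := abs_of_nonneg (by linarith)
  have hratio : (n + 1) * g0 n x ≤ g1 x :=
    calc (n + 1) * g0 n x ≤ (2 * n) * (2 / (n : ℝ) ^ 4) :=
          mul_le_mul (by linarith) (g0_le_two_div_pow_four hn (by linarith) (by nlinarith))
            (g0_pos hn x).le (by positivity)
      _ = 4 / (n : ℝ) ^ 3 := by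
          field_simp
          norm_num
      _ ≤ 1 / (1500 * T ^ 2) := by
          rw [div_le_div_iff₀ (by positivity) (by positivity)]
          have hsq : (24000 * T) ^ 2 ≤ (n : ℝ) ^ 2 := by gcongr
          have hcube : (n : ℝ) ^ 2 ≤ n ^ 3 := pow_le_pow_right₀ hn1 (by norm_num)
          nlinarith
      _ ≤ g1 x := one_div_le_g1_of_le hT (by linarith)
  calc g0 n x ≤ 1 / n * (g1 x - g0 n x) := by
        rw [one_div_mul_eq_div, le_div_iff₀ hn0]
        linarith
    _ ≤ α * (g1 x - g0 n x) := by
        refine mul_le_mul_of_nonneg_right h0 ?_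
        nlinarith [g0_pos hn x]

lemma phi_mul_div_g0_le (hn : 0 < n) (x : ℝ) :
    phi x * (g1 x / g0 n x) ≤ (1 + 1 / (n : ℝ) ^ 2) * g1 x := by
  rw [mul_div_assoc', div_le_iff₀ (g0_pos hn x)]
  linarith [mul_le_mul_of_nonneg_right (phi_le_mul_g0 hn x) (g1_pos x).le]

lemma phi_mul_score_le (hn : 0 < n) (h0 : 1 / (n : ℝ) ≤ α) (hα2 : α ≤ 1 / 2) (hT : 1 ≤ T)
    (hT2 : 8 * Real.log n ≤ T ^ 2) (hTn : 24000 * T ≤ n) (x : ℝ) :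
    phi x * score n α x ≤ (1 + 1 / (n : ℝ) ^ 2) * g1 x - phi x -
      (Set.Icc T (2 * T)).indicator (fun _ => 1 / (12000 * T ^ 2)) x := by
  have hα0 : 0 ≤ α := (by positivity : (0 : ℝ) ≤ 1 / n).trans h0
  have hg0 := g0_pos hn x
  have hratio := phi_mul_div_g0_le hn x
  by_cases hx : x ∈ Set.Icc T (2 * T)
  · have hscore := score_le_of_dominant hn hα0 hα2 (g0_le_mul_sub_of_mem_Icc hn h0 hT hT2 hTn hx)
    have habs : |x| = x := abs_of_nonneg (by linarith [hx.1])
    have hgain : g1 x / 8 ≤ phi x * (g1 x / (4 * g0 n x)) := by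
      have hphi := g0_le_two_mul_phi hn (x := x)
        (by linarith [hx.2, twelve_mul_le_spikeParam n])
      rw [mul_div_assoc', div_le_div_iff₀ (by norm_num) (by positivity)]
      linarith [mul_le_mul_of_nonneg_right hphi (g1_pos x).le]
    have hg1 : 1 / (12000 * T ^ 2) ≤ g1 x / 8 :=
      calc 1 / (12000 * T ^ 2) = 1 / (1500 * T ^ 2) / 8 := by
            field_simp
            norm_num
        _ ≤ g1 x / 8 := by
            gcongr
            exact one_div_le_g1_of_le hT (by linarith [hx.2])
    rw [Set.indicator_of_mem hx]
    linarith [mul_le_mul_of_nonneg_left hscore (phi_pos x).le]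
  · rw [Set.indicator_of_notMem hx]
    linarith [mul_le_mul_of_nonneg_left (score_le_ratio hn ⟨hα0, by linarith⟩ x) (phi_pos x).le]

lemma phi_mul_sq_score_le (hn : 0 < n) (hα0 : 0 < α) (hα2 : α ≤ 1 / 2) (x : ℝ) :
    phi x * score n α x ^ 2 ≤ 4 * phi x + 4 / α * g1 x := by
  have hg1 := g1_pos x
  have hphi : phi x / g0 n x ≤ 2 := (div_le_iff₀ (g0_pos hn x)).2 (phi_le_two_mul_g0 hn x)
  calc phi x * score n α x ^ 2 ≤ phi x * (4 + 2 / α * (g1 x / g0 n x)) :=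
        mul_le_mul_of_nonneg_left (sq_score_le hn hα0 hα2 x) (phi_pos x).le
    _ = 4 * phi x + phi x / g0 n x * (2 / α * g1 x) := by ring
    _ ≤ 4 * phi x + 2 * (2 / α * g1 x) := by gcongr
    _ = 4 * phi x + 4 / α * g1 x := by ring

lemma memLp_score (hn : 0 < n) (hα0 : 0 < α) (hα2 : α ≤ 1 / 2) (p : ℝ≥0∞) (ν : Measure ℝ)
    [IsFiniteMeasure ν] : MemLp (score n α) p ν :=
  memLp_of_bounded (ae_of_all _ fun x =>
    ⟨neg_two_le_score hn hα0.le hα2 x, score_le_inv hn hα0 (by linarith) x⟩)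
    (measurable_score n α).aestronglyMeasurable p

lemma integral_gaussianReal_le {F H : ℝ → ℝ} (hF : Integrable F (gaussianReal 0 1))
    (hFH : ∀ x, phi x * F x ≤ H x) (hH : Integrable H) :
    ∫ x, F x ∂gaussianReal 0 1 ≤ ∫ x, H x := by
  rw [integrable_gaussianReal_iff] at hF
  rw [integral_gaussianReal_eq_integral_phi_mul]
  simp only [zero_sub, phi_neg] at hF ⊢
  exact integral_mono hF hH hFH

/-- Since `g₁` and `φ` are densities, only the window `[T, 2T]`, where the slab dominates, keeps
the mean of the score away from `0`. -/
lemma integral_score_le (hn : 0 < n) (h0 : 1 / (n : ℝ) ≤ α) (hα2 : α ≤ 1 / 2) (hT : 1 ≤ T)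
    (hT2 : 8 * Real.log n ≤ T ^ 2) (hTn : 24000 * T ≤ n) :
    ∫ x, score n α x ∂gaussianReal 0 1 ≤ -(1 / (24000 * T)) := by
  have hα0 : 0 < α := (by positivity : (0 : ℝ) < 1 / n).trans_le h0
  have hg1 := integrable_g1.const_mul (1 + 1 / (n : ℝ) ^ 2)
  have hsub : Integrable fun x => (1 + 1 / (n : ℝ) ^ 2) * g1 x - phi x := hg1.sub integrable_phi
  have hJ := integrable_indicator_Icc_const T (2 * T) (1 / (12000 * T ^ 2))
  have h := integral_gaussianReal_le ((memLp_score hn hα0 hα2 1 _).integrable le_rfl)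
    (phi_mul_score_le hn h0 hα2 hT hT2 hTn) (hsub.sub hJ)
  rw [integral_sub hsub hJ, integral_indicator_Icc_const (by linarith),
    integral_sub hg1 integrable_phi, integral_const_mul, integral_g1, integral_phi] at h
  have hn2 : 1 / (n : ℝ) ^ 2 ≤ 1 / (24000 * T) :=
    one_div_le_one_div_of_le (by positivity) (by nlinarith)
  calc ∫ x, score n α x ∂gaussianReal 0 1
      ≤ 1 / (n : ℝ) ^ 2 - (2 * T - T) * (1 / (12000 * T ^ 2)) := by linarith
    _ = 1 / (n : ℝ) ^ 2 - 2 * (1 / (24000 * T)) := by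
        field_simp
        ring
    _ ≤ -(1 / (24000 * T)) := by linarith

lemma integral_sq_score_le (hn : 0 < n) (hα0 : 0 < α) (hα2 : α ≤ 1 / 2) :
    ∫ x, score n α x ^ 2 ∂gaussianReal 0 1 ≤ 8 / α := by
  have hphi := integrable_phi.const_mul 4
  have hg1 := integrable_g1.const_mul (4 / α)
  have h := integral_gaussianReal_le (memLp_score hn hα0 hα2 2 _).integrable_sq
    (phi_mul_sq_score_le hn hα0 hα2) (hphi.add hg1)
  rw [integral_add hphi hg1, integral_const_mul, integral_const_mul, integral_phi, integral_g1] at h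
  have hα : 4 ≤ 4 / α := (le_div_iff₀ hα0).2 (by linarith)
  calc ∫ x, score n α x ^ 2 ∂gaussianReal 0 1 ≤ 4 / α + 4 / α := by linarith
    _ = 8 / α := by ring

lemma mgf_le_exp_of_abs_mul_le_one {Ω : Type*} [MeasurableSpace Ω] {μ : Measure Ω}
    [IsProbabilityMeasure μ] {F : Ω → ℝ} {η m v : ℝ} (hη : 0 ≤ η) (hb : ∀ ω, |η * F ω| ≤ 1)
    (hF : Integrable F μ) (hF2 : Integrable (fun ω => F ω ^ 2) μ) (hm : ∫ ω, F ω ∂μ ≤ m)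
    (hv : ∫ ω, F ω ^ 2 ∂μ ≤ v) : mgf F μ η ≤ Real.exp (η * m + η ^ 2 * v) := by
  have hI : Integrable (fun ω => 1 + η * F ω) μ := (integrable_const 1).add (hF.const_mul η)
  calc mgf F μ η ≤ ∫ ω, (1 + η * F ω + η ^ 2 * F ω ^ 2) ∂μ :=
        integral_mono_of_nonneg (ae_of_all _ fun ω => (Real.exp_pos _).le)
          (hI.add (hF2.const_mul _)) (ae_of_all _ fun ω => by
            have := (abs_le.1 (Real.abs_exp_sub_one_sub_id_le (hb ω))).2
            simp only
            linarith)
    _ = 1 + η * ∫ ω, F ω ∂μ + η ^ 2 * ∫ ω, F ω ^ 2 ∂μ := by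
        rw [integral_add hI (hF2.const_mul _), integral_add (integrable_const 1) (hF.const_mul η),
          integral_const_mul, integral_const_mul, integral_const, probReal_univ, one_smul]
    _ ≤ η * m + η ^ 2 * v + 1 := by
        linarith [mul_le_mul_of_nonneg_left hm hη, mul_le_mul_of_nonneg_left hv (sq_nonneg η)]
    _ ≤ Real.exp (η * m + η ^ 2 * v) := Real.add_one_le_exp _

/-- The tilt `α / (384000 T)` makes the second order term half as large as the drift. -/
lemma mgf_score_le (hn : 0 < n) (h0 : 1 / (n : ℝ) ≤ α) (hα2 : α ≤ 1 / 2) (hT : 1 ≤ T)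
    (hT2 : 8 * Real.log n ≤ T ^ 2) (hTn : 24000 * T ≤ n) :
    mgf (score n α) (gaussianReal 0 1) (α / (384000 * T)) ≤
      Real.exp (-(α / (384000 * T)) / (48000 * T)) := by
  have hα0 : 0 < α := (by positivity : (0 : ℝ) < 1 / n).trans_le h0
  have hηα : α / (384000 * T) ≤ α := div_le_self hα0.le (by linarith)
  have hb : ∀ x, |α / (384000 * T) * score n α x| ≤ 1 := fun x => by
    set η := α / (384000 * T)
    have hη : 0 ≤ η := by positivity
    have hscore := (le_div_iff₀' hα0).1 (score_le_inv hn hα0 (by linarith) x)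
    rw [abs_le]
    constructor
    · nlinarith [neg_two_le_score hn hα0.le hα2 x]
    · rcases le_total (score n α x) 0 with h | h
      · exact (mul_nonpos_of_nonneg_of_nonpos hη h).trans zero_le_one
      · exact (mul_le_mul_of_nonneg_right hηα h).trans hscore
  refine (mgf_le_exp_of_abs_mul_le_one (by positivity) hb
    ((memLp_score hn hα0 hα2 1 _).integrable le_rfl) (memLp_score hn hα0 hα2 2 _).integrable_sq
    (integral_score_le hn h0 hα2 hT hT2 hTn) (integral_sq_score_le hn hα0 hα2)).trans_eq ?_
  congr 1
  field_simp
  norm_num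

end

/-! ### The marginal maximum likelihood estimator -/

section

variable {n : ℕ} {c α : ℝ} {αhat : (Fin n → ℝ) → ℝ}

lemma logMarginal_sub_le (hn : 0 < n) {β : ℝ} (hα : α ∈ Set.Icc (0 : ℝ) 1)
    (hβ : β ∈ Set.Icc (0 : ℝ) 1) (X : Fin n → ℝ) :
    logMarginal n β X - logMarginal n α X ≤ (β - α) * ∑ i, score n α (X i) := by
  rw [logMarginal, logMarginal, ← Finset.sum_sub_distrib, Finset.mul_sum]
  refine Finset.sum_le_sum fun i _ => ?_
  have hα' := marginal_pos hn hα (X i)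
  have hβ' := marginal_pos hn hβ (X i)
  calc Real.log (marginal n β (X i)) - Real.log (marginal n α (X i))
      = Real.log (marginal n β (X i) / marginal n α (X i)) :=
        (Real.log_div hβ'.ne' hα'.ne').symm
    _ ≤ marginal n β (X i) / marginal n α (X i) - 1 :=
        Real.log_le_sub_one_of_pos (div_pos hβ' hα')
    _ = (marginal n β (X i) - marginal n α (X i)) / marginal n α (X i) := div_sub_one hα'.ne'
    _ = (β - α) * score n α (X i) := by
        rw [score, mul_div_assoc']
        congr 1
        unfold marginal
        ring

lemma sum_score_nonneg (hn : 0 < n) (hα : α ∈ Set.Icc (0 : ℝ) 1) (h : IsMMLE c n αhat)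
    (hc : c * Real.log n / n ≤ α) {X : Fin n → ℝ} (hX : α < αhat X) :
    0 ≤ ∑ i, score n α (X i) := by
  obtain ⟨hmem, hmax⟩ := h X
  have hle : logMarginal n α X ≤ logMarginal n (αhat X) X := hmax ⟨hc, hα.2⟩
  have hsub := logMarginal_sub_le hn hα ⟨hα.1.trans hX.le, hmem.2⟩ X
  exact nonneg_of_mul_nonneg_right ((sub_nonneg.2 hle).trans hsub) (sub_pos.2 hX)

/-- The coordinates at which the signal `θ` vanishes. -/
def nullSet (θ : Fin n → ℝ) : Finset (Fin n) := Finset.univ.filter fun i => θ i = 0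

variable {θ : Fin n → ℝ} {s : ℕ}

lemma mem_nullSet {i : Fin n} : i ∈ nullSet θ ↔ θ i = 0 := by simp [nullSet]

lemma card_nullSet_le (θ : Fin n → ℝ) : (nullSet θ).card ≤ n :=
  (Finset.card_le_univ _).trans_eq (Fintype.card_fin n)

lemma card_compl_nullSet_le (hθ : θ ∈ sparseClass n s) : (nullSet θ)ᶜ.card ≤ s := by
  rwa [nullSet, Finset.compl_filter]

lemma neg_div_le_sum_nullSet_score (hn : 0 < n) (hα0 : 0 < α) (hα1 : α ≤ 1)
    (h : IsMMLE c n αhat) (hc : c * Real.log n / n ≤ α) (hθ : θ ∈ sparseClass n s)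
    {X : Fin n → ℝ} (hX : α < αhat X) : -(s / α) ≤ ∑ i ∈ nullSet θ, score n α (X i) := by
  have hsignal : ∑ i ∈ (nullSet θ)ᶜ, score n α (X i) ≤ s / α :=
    calc ∑ i ∈ (nullSet θ)ᶜ, score n α (X i) ≤ (nullSet θ)ᶜ.card • (1 / α) :=
          Finset.sum_le_card_nsmul _ _ _ fun i _ => score_le_inv hn hα0 hα1 (X i)
      _ = (nullSet θ)ᶜ.card / α := by rw [nsmul_eq_mul, mul_one_div]
      _ ≤ s / α := by
          gcongr
          exact card_compl_nullSet_le hθ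
  have hsum := sum_score_nonneg hn ⟨hα0.le, hα1⟩ h hc hX
  rw [← Finset.sum_add_sum_compl (nullSet θ)] at hsum
  linarith

/-! ### The law of the sample -/

instance (θ : Fin n → ℝ) : IsProbabilityMeasure (sampleLaw θ) := by
  unfold sampleLaw
  infer_instance

lemma measurePreserving_eval_sampleLaw (θ : Fin n → ℝ) (i : Fin n) :
    MeasurePreserving (Function.eval i) (sampleLaw θ) (gaussianReal (θ i) 1) :=
  measurePreserving_eval (fun i => gaussianReal (θ i) 1) i

lemma lintegral_sum_nullSet_le (θ : Fin n → ℝ) {F : ℝ → ℝ≥0∞} {B : ℝ} (hF : Measurable F)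
    (h : ∫⁻ x, F x ∂(gaussianReal 0 1) ≤ ENNReal.ofReal B) :
    ∫⁻ X, ∑ i ∈ nullSet θ, F (X i) ∂(sampleLaw θ) ≤ ENNReal.ofReal (n * B) := by
  rw [lintegral_finsetSum _ fun i _ => by fun_prop]
  calc ∑ i ∈ nullSet θ, ∫⁻ X, F (X i) ∂(sampleLaw θ)
      ≤ (nullSet θ).card • ENNReal.ofReal B := by
        refine Finset.sum_le_card_nsmul _ _ _ fun i hi => ?_
        rw [← mem_nullSet.1 hi] at h
        exact ((measurePreserving_eval_sampleLaw θ i).lintegral_comp hF).trans_le h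
    _ ≤ n * ENNReal.ofReal B := by
        rw [nsmul_eq_mul]
        gcongr
        exact card_nullSet_le θ
    _ = ENNReal.ofReal (n * B) := by rw [ENNReal.ofReal_mul n.cast_nonneg, ENNReal.ofReal_natCast]

lemma measurable_score_eval (n : ℕ) (α : ℝ) (i : Fin n) :
    Measurable fun X : Fin n → ℝ => score n α (X i) :=
  (measurable_score n α).comp (measurable_pi_apply i)

lemma iIndepFun_score_eval (α : ℝ) (θ : Fin n → ℝ) :
    iIndepFun (fun i (X : Fin n → ℝ) => score n α (X i)) (sampleLaw θ) :=
  iIndepFun_pi fun _ => (measurable_score n α).aemeasurable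

lemma mgf_score_eval (α : ℝ) (θ : Fin n → ℝ) (i : Fin n) (t : ℝ) :
    mgf (fun X : Fin n → ℝ => score n α (X i)) (sampleLaw θ) t =
      mgf (score n α) (gaussianReal (θ i) 1) t := by
  have hmeas : Measurable fun x => Real.exp (t * score n α x) :=
    Real.measurable_exp.comp ((measurable_score n α).const_mul t)
  have hmp := measurePreserving_eval_sampleLaw θ i
  rw [← hmp.map_eq, mgf_map hmp.measurable.aemeasurable hmeas.aestronglyMeasurable]
  rfl

lemma measureReal_le_sum_nullSet_score_le (hn : 0 < n) (h0 : 1 / (n : ℝ) ≤ α) (hα2 : α ≤ 1 / 2)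
    {T : ℝ} (hT : 1 ≤ T) (hT2 : 8 * Real.log n ≤ T ^ 2) (hTn : 24000 * T ≤ n) (θ : Fin n → ℝ)
    (b : ℝ) :
    (sampleLaw θ).real {X | -b ≤ ∑ i ∈ nullSet θ, score n α (X i)} ≤
      Real.exp (α / (384000 * T) * (b - (nullSet θ).card / (48000 * T))) := by
  have hα0 : 0 < α := (by positivity : (0 : ℝ) < 1 / n).trans_le h0
  have hind := iIndepFun_score_eval α θ
  have hmeas := measurable_score_eval n α
  set η := α / (384000 * T)
  have hη : 0 ≤ η := by positivity
  have hchernoff := measure_ge_le_exp_mul_mgf (-b) hη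
    (hind.integrable_exp_mul_sum hmeas (s := nullSet θ) fun i _ =>
      integrable_exp_mul_of_le η (1 / α) hη (hmeas i).aemeasurable
        (ae_of_all _ fun X => score_le_inv hn hα0 (by linarith) (X i)))
  simp only [Finset.sum_apply] at hchernoff
  calc (sampleLaw θ).real {X | -b ≤ ∑ i ∈ nullSet θ, score n α (X i)}
      ≤ Real.exp (-η * -b) * ∏ i ∈ nullSet θ, mgf (fun X => score n α (X i)) (sampleLaw θ) η := by
        rwa [← hind.mgf_sum hmeas]
    _ ≤ Real.exp (-η * -b) * ∏ _i ∈ nullSet θ, Real.exp (-η / (48000 * T)) := by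
        gcongr with i hi
        · exact fun i _ => mgf_nonneg
        rw [mgf_score_eval, mem_nullSet.1 hi]
        exact mgf_score_le hn h0 hα2 hT hT2 hTn
    _ = Real.exp (η * (b - (nullSet θ).card / (48000 * T))) := by
        rw [Finset.prod_const, ← Real.exp_nat_mul, ← Real.exp_add]
        ring_nf

/-! ### Decomposition of the risk -/

/-- The contribution of the coordinates in `nullSet θ` to the risk of the plug-in posterior. -/
def nullRisk (αhat : (Fin n → ℝ) → ℝ) (θ : Fin n → ℝ) : ℝ≥0∞ :=
  ∫⁻ X, ∑ i ∈ nullSet θ, coordRisk n (αhat X) (X i) 0 ∂(sampleLaw θ)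

lemma lintegral_posterior (hn : 0 < n) (hα : α ∈ Set.Icc (0 : ℝ) 1) (X θ₀ : Fin n → ℝ) :
    ∫⁻ θ, ENNReal.ofReal (∑ i, (θ i - θ₀ i) ^ 2) ∂(posterior n α X) =
      ∑ i, coordRisk n α (X i) (θ₀ i) := by
  have hprob : ∀ i, IsProbabilityMeasure (coordPosterior n α (X i)) := fun i =>
    (coord_bayes hn hα (X i)).2.1
  simp_rw [fun θ : Fin n → ℝ =>
    ENNReal.ofReal_sum_of_nonneg fun i (_ : i ∈ Finset.univ) => sq_nonneg (θ i - θ₀ i)]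
  rw [lintegral_finsetSum _ fun i _ => by fun_prop]
  refine Finset.sum_congr rfl fun i _ => ?_
  exact (measurePreserving_eval (fun i => coordPosterior n α (X i)) i).lintegral_comp
    (f := fun u => ENNReal.ofReal ((u - θ₀ i) ^ 2)) (by fun_prop)

lemma lintegral_signal_bound_le (hL : 1 ≤ Real.log n) (θ : Fin n → ℝ) (i : Fin n) :
    ∫⁻ X, ENNReal.ofReal (1100000 * Real.log n + 4 * (X i - θ i) ^ 2) ∂(sampleLaw θ) ≤
      ENNReal.ofReal (3000000 * Real.log n) := by
  have hbound : ∀ x : ℝ, 1100000 * Real.log n + 4 * x ^ 2 ≤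
      1500000 * Real.log n * Real.exp (x ^ 2 / 4) := fun x => by
    nlinarith [sq_le_exp x, Real.one_le_exp (by positivity : 0 ≤ x ^ 2 / 4)]
  calc ∫⁻ X, ENNReal.ofReal (1100000 * Real.log n + 4 * (X i - θ i) ^ 2) ∂(sampleLaw θ)
      = ∫⁻ x, ENNReal.ofReal (1100000 * Real.log n + 4 * x ^ 2) ∂(gaussianReal 0 1) :=
        ((measurePreserving_sub_gaussianReal (θ i)).comp
          (measurePreserving_eval_sampleLaw θ i)).lintegral_comp
          (f := fun x => ENNReal.ofReal (1100000 * Real.log n + 4 * x ^ 2)) (by fun_prop)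
    _ ≤ ENNReal.ofReal (2 * (1500000 * Real.log n)) :=
        lintegral_gaussian_le_of_le_exp (fun x => by positivity) hbound
    _ = ENNReal.ofReal (3000000 * Real.log n) := by
        congr 1
        ring

lemma plugInRisk_le (hn : 0 < n) (hL : 1 ≤ Real.log n)
    (h : ∀ X, αhat X ∈ Set.Icc (1 / (n : ℝ)) 1) (hθ : θ ∈ sparseClass n s) :
    plugInRisk αhat θ ≤ ENNReal.ofReal (s * (3000000 * Real.log n)) + nullRisk αhat θ := by
  have hα : ∀ X, αhat X ∈ Set.Icc (0 : ℝ) 1 := fun X =>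
    Set.Icc_subset_Icc_left (by positivity) (h X)
  calc plugInRisk αhat θ
      = ∫⁻ X, ∑ i, coordRisk n (αhat X) (X i) (θ i) ∂(sampleLaw θ) :=
        lintegral_congr fun X => lintegral_posterior hn (hα X) X θ
    _ ≤ ∫⁻ X, (∑ i ∈ (nullSet θ)ᶜ, ENNReal.ofReal (1100000 * Real.log n + 4 * (X i - θ i) ^ 2) +
          ∑ i ∈ nullSet θ, coordRisk n (αhat X) (X i) 0) ∂(sampleLaw θ) := by
        refine lintegral_mono fun X => ?_
        rw [← Finset.sum_compl_add_sum (nullSet θ)]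
        gcongr with i _ i hi
        · exact coordRisk_signal_le hn hL (h X).1 (h X).2 (X i) (θ i)
        · rw [mem_nullSet.1 hi]
    _ = ∑ i ∈ (nullSet θ)ᶜ, ∫⁻ X, ENNReal.ofReal (1100000 * Real.log n + 4 * (X i - θ i) ^ 2)
          ∂(sampleLaw θ) + nullRisk αhat θ := by
        rw [lintegral_add_left (by fun_prop), lintegral_finsetSum _ fun i _ => by fun_prop,
          nullRisk]
    _ ≤ (nullSet θ)ᶜ.card • ENNReal.ofReal (3000000 * Real.log n) + nullRisk αhat θ := by
        gcongr
        exact Finset.sum_le_card_nsmul _ _ _ fun i _ => lintegral_signal_bound_le hL θ i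
    _ ≤ ENNReal.ofReal (s * (3000000 * Real.log n)) + nullRisk αhat θ := by
        rw [nsmul_eq_mul, ENNReal.ofReal_mul s.cast_nonneg, ENNReal.ofReal_natCast]
        gcongr
        exact card_compl_nullSet_le hθ

lemma nullRisk_le_const_mul (hn : 0 < n) (h : ∀ X, αhat X ∈ Set.Icc (0 : ℝ) 1)
    (θ : Fin n → ℝ) : nullRisk αhat θ ≤ ENNReal.ofReal (n * 230) := by
  have hn1 : (1 : ℝ) ≤ n := by exact_mod_cast hn
  have hrisk : ∀ (X : Fin n → ℝ) (i : Fin n),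
      coordRisk n (αhat X) (X i) 0 ≤ ENNReal.ofReal (75 + 2 * X i ^ 2 + X i ^ 4) := fun X i => by
    refine (coordRisk_zero_le hn (h X) (X i)).trans (ENNReal.ofReal_le_ofReal ?_)
    have hspike : (1 + X i ^ 4) / (n : ℝ) ^ 2 ≤ 1 + X i ^ 4 :=
      div_le_self (by positivity) (one_le_pow₀ hn1)
    have hslab := mul_le_of_le_one_left (by positivity : 0 ≤ 74 + 2 * X i ^ 2)
      (postWeight_le_one hn (h X) (X i))
    linarith
  have hbound : ∀ x : ℝ, 75 + 2 * x ^ 2 + x ^ 4 ≤ 115 * Real.exp (x ^ 2 / 4) := fun x => by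
    linarith [sq_le_exp x, pow_four_le_exp x, Real.one_le_exp (by positivity : 0 ≤ x ^ 2 / 4)]
  refine (lintegral_mono fun X => Finset.sum_le_sum fun i _ => hrisk X i).trans
    (lintegral_sum_nullSet_le θ (F := fun x => ENNReal.ofReal (75 + 2 * x ^ 2 + x ^ 4))
      (by fun_prop) ?_)
  refine (lintegral_gaussian_le_of_le_exp (fun x => by positivity) hbound).trans_eq ?_
  norm_num

/-- A majorant of the risk of a null coordinate at every weight up to `α`; at larger weights it is
a majorant up to an additional `n`. -/
def nullMajorant (n : ℕ) (α x : ℝ) : ℝ :=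
  (1 + x ^ 4) / (n : ℝ) ^ 2 + (74 + 2 * x ^ 2) ^ 2 / n + postWeight n α x * (74 + 2 * x ^ 2)

lemma measurable_nullMajorant (n : ℕ) (α : ℝ) : Measurable (nullMajorant n α) :=
  Measurable.add (by fun_prop) ((measurable_postWeight n α).mul (by fun_prop))

lemma nullMajorant_nonneg (hn : 0 < n) (hα : α ∈ Set.Icc (0 : ℝ) 1) (x : ℝ) :
    0 ≤ nullMajorant n α x :=
  add_nonneg (by positivity) (mul_nonneg (postWeight_nonneg hn hα x) (by positivity))

lemma coordRisk_zero_le_nullMajorant (hn : 0 < n) {β : ℝ} (hα : α ∈ Set.Icc (0 : ℝ) 1)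
    (hβ : β ∈ Set.Icc (0 : ℝ) 1) (hβα : β ≤ α) (x : ℝ) :
    coordRisk n β x 0 ≤ ENNReal.ofReal (nullMajorant n α x) := by
  refine (coordRisk_zero_le hn hβ x).trans (ENNReal.ofReal_le_ofReal ?_)
  have hmono := mul_le_mul_of_nonneg_right (postWeight_mono hn hβ hα hβα x)
    (by positivity : 0 ≤ 74 + 2 * x ^ 2)
  have hsq : 0 ≤ (74 + 2 * x ^ 2) ^ 2 / (n : ℝ) := by positivity
  unfold nullMajorant
  linarith

lemma coordRisk_zero_le_nullMajorant_add (hn : 0 < n) {β : ℝ} (hα : α ∈ Set.Icc (0 : ℝ) 1)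
    (hβ : β ∈ Set.Icc (0 : ℝ) 1) (x : ℝ) :
    coordRisk n β x 0 ≤ ENNReal.ofReal (nullMajorant n α x) + n := by
  have hn0 : (0 : ℝ) < n := by exact_mod_cast hn
  rw [← ENNReal.ofReal_natCast, ← ENNReal.ofReal_add (nullMajorant_nonneg hn hα x) hn0.le]
  refine (coordRisk_zero_le hn hβ x).trans (ENNReal.ofReal_le_ofReal ?_)
  unfold nullMajorant
  set y := 74 + 2 * x ^ 2
  have hy : 0 ≤ y := by positivity
  have hone := mul_le_of_le_one_left hy (postWeight_le_one hn hβ x)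
  have hyn : y ≤ y ^ 2 / n + n := by
    rw [← sub_le_iff_le_add, le_div_iff₀ hn0]
    nlinarith [sq_nonneg (y - n)]
  linarith [mul_nonneg (postWeight_nonneg hn hα x) hy]

lemma lintegral_nullMajorant_le (hn : 0 < n) (hα0 : 0 ≤ α) (hα2 : α ≤ 1 / 2) {T : ℝ}
    (hT : 0 ≤ T) (hT2 : 8 * Real.log n ≤ T ^ 2) :
    ∫⁻ x, ENNReal.ofReal (nullMajorant n α x) ∂(gaussianReal 0 1) ≤
      ENNReal.ofReal (336 * α * T + 13777 / n) := by
  have hn1 : (1 : ℝ) ≤ n := by exact_mod_cast hn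
  have hbound : ∀ x : ℝ, (1 + x ^ 4) / (n : ℝ) ^ 2 + (74 + 2 * x ^ 2) ^ 2 / n ≤
      6821 / n * Real.exp (x ^ 2 / 4) := fun x =>
    calc (1 + x ^ 4) / (n : ℝ) ^ 2 + (74 + 2 * x ^ 2) ^ 2 / n
        ≤ (1 + x ^ 4) / n + (74 + 2 * x ^ 2) ^ 2 / n := by
          gcongr
          exact le_self_pow₀ hn1 two_ne_zero
      _ = (5477 + 296 * x ^ 2 + 5 * x ^ 4) / n := by ring
      _ ≤ 6821 * Real.exp (x ^ 2 / 4) / n := by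
          gcongr
          linarith [sq_le_exp x, pow_four_le_exp x,
            Real.one_le_exp (by positivity : 0 ≤ x ^ 2 / 4)]
      _ = 6821 / n * Real.exp (x ^ 2 / 4) := by ring
  calc ∫⁻ x, ENNReal.ofReal (nullMajorant n α x) ∂(gaussianReal 0 1)
      = ∫⁻ x, (ENNReal.ofReal ((1 + x ^ 4) / (n : ℝ) ^ 2 + (74 + 2 * x ^ 2) ^ 2 / n) +
          ENNReal.ofReal (postWeight n α x * (74 + 2 * x ^ 2))) ∂(gaussianReal 0 1) :=
        lintegral_congr fun x => ENNReal.ofReal_add (by positivity)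
          (mul_nonneg (postWeight_nonneg hn ⟨hα0, by linarith⟩ x) (by positivity))
    _ ≤ ENNReal.ofReal (2 * (6821 / n)) + ENNReal.ofReal (336 * α * T + 135 / n) := by
        rw [lintegral_add_left (by fun_prop)]
        exact add_le_add (lintegral_gaussian_le_of_le_exp (fun x => by positivity) hbound)
          (lintegral_postWeight_mul_le hn hα0 hα2 hT hT2)
    _ = ENNReal.ofReal (336 * α * T + 13777 / n) := by
        rw [← ENNReal.ofReal_add (by positivity) (by positivity)]
        congr 1
        ring

lemma sum_coordRisk_zero_le (hn : 0 < n) {β : ℝ} (hα : α ∈ Set.Icc (0 : ℝ) 1)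
    (hβ : β ∈ Set.Icc (0 : ℝ) 1) (θ X : Fin n → ℝ) {A : Set (Fin n → ℝ)} (hA : α < β → X ∈ A) :
    ∑ i ∈ nullSet θ, coordRisk n β (X i) 0 ≤
      ∑ i ∈ nullSet θ, ENNReal.ofReal (nullMajorant n α (X i)) +
        A.indicator (fun _ => (n : ℝ≥0∞) ^ 2) X := by
  rcases le_or_gt β α with hβα | hαβ
  · exact (Finset.sum_le_sum fun i _ =>
      coordRisk_zero_le_nullMajorant hn hα hβ hβα (X i)).trans le_self_add
  · rw [Set.indicator_of_mem (hA hαβ)]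
    refine (Finset.sum_le_sum fun i _ =>
      coordRisk_zero_le_nullMajorant_add hn hα hβ (X i)).trans ?_
    rw [Finset.sum_add_distrib, Finset.sum_const, nsmul_eq_mul, sq]
    gcongr
    exact card_nullSet_le θ

lemma nullRisk_le (hn : 0 < n) (hα0 : 0 ≤ α) (hα2 : α ≤ 1 / 2) {T : ℝ} (hT : 0 ≤ T)
    (hT2 : 8 * Real.log n ≤ T ^ 2) (h : ∀ X, αhat X ∈ Set.Icc (0 : ℝ) 1) (θ : Fin n → ℝ)
    {A : Set (Fin n → ℝ)} (hA : MeasurableSet A) (hαA : ∀ X, α < αhat X → X ∈ A) :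
    nullRisk αhat θ ≤
      ENNReal.ofReal (336 * (n * α * T) + 13777 + (n : ℝ) ^ 2 * (sampleLaw θ).real A) := by
  calc nullRisk αhat θ
      ≤ ∫⁻ X, (∑ i ∈ nullSet θ, ENNReal.ofReal (nullMajorant n α (X i)) +
          A.indicator (fun _ => (n : ℝ≥0∞) ^ 2) X) ∂(sampleLaw θ) :=
        lintegral_mono fun X =>
          sum_coordRisk_zero_le hn ⟨hα0, by linarith⟩ (h X) θ X (hαA X)
    _ = ∫⁻ X, ∑ i ∈ nullSet θ, ENNReal.ofReal (nullMajorant n α (X i)) ∂(sampleLaw θ) +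
          (n : ℝ≥0∞) ^ 2 * sampleLaw θ A := by
        rw [lintegral_add_right _ (measurable_const.indicator hA), lintegral_indicator_const hA]
    _ ≤ ENNReal.ofReal (n * (336 * α * T + 13777 / n)) +
          ENNReal.ofReal ((n : ℝ) ^ 2 * (sampleLaw θ).real A) := by
        rw [ENNReal.ofReal_mul (p := (n : ℝ) ^ 2) (by positivity), ofReal_measureReal,
          ENNReal.ofReal_pow n.cast_nonneg, ENNReal.ofReal_natCast]
        gcongr
        exact lintegral_sum_nullSet_le θ (measurable_nullMajorant n α).ennreal_ofReal
          (lintegral_nullMajorant_le hn hα0 hα2 hT hT2)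
    _ = ENNReal.ofReal (336 * (n * α * T) + 13777 + (n : ℝ) ^ 2 * (sampleLaw θ).real A) := by
        rw [← ENNReal.ofReal_add (by positivity) (by positivity)]
        congr 1
        field_simp

end

/-! ### The risk bound -/

section

variable {n s : ℕ} {c K : ℝ} {αhat : (Fin n → ℝ) → ℝ} {θ : Fin n → ℝ}

/-- The weight that the marginal maximum likelihood estimator rarely exceeds under a signal with
`s` nonzero coordinates. The term `log² n` makes the concentration of the score strong enough for
small `s`. -/
def thresholdWeight (K : ℝ) (n s : ℕ) : ℝ := K * (s * √(Real.log n) + Real.log n ^ 2) / n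

lemma sq_sqrt_log (n : ℕ) : √(Real.log n) ^ 2 = Real.log n :=
  Real.sq_sqrt (Real.log_natCast_nonneg n)

lemma mul_thresholdWeight (hn : 0 < n) :
    n * thresholdWeight K n s = K * (s * √(Real.log n) + Real.log n ^ 2) :=
  mul_div_cancel₀ _ (Nat.cast_ne_zero.2 hn.ne')

lemma thresholdWeight_le_half (hn : 0 < n) (hL : 16 * K ^ 2 ≤ Real.log n)
    (hLn : 4 * K * Real.log n ^ 2 ≤ n) (hs : s * Real.log n ≤ n) :
    thresholdWeight K n s ≤ 1 / 2 := by
  have hKR : 4 * K ≤ √(Real.log n) := Real.le_sqrt_of_sq_le (by linarith)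
  have hsR : 4 * K * (s * √(Real.log n)) ≤ n :=
    calc 4 * K * (s * √(Real.log n)) ≤ √(Real.log n) * (s * √(Real.log n)) := by gcongr
      _ = s * √(Real.log n) ^ 2 := by ring
      _ ≤ n := by rwa [sq_sqrt_log]
  rw [thresholdWeight, div_le_iff₀ (by exact_mod_cast hn)]
  linarith

lemma mul_log_div_le_thresholdWeight (hK : 0 ≤ K) (hcK : c ≤ K) (hL : 1 ≤ Real.log n) :
    c * Real.log n / n ≤ thresholdWeight K n s := by
  have hlog : Real.log n ≤ s * √(Real.log n) + Real.log n ^ 2 :=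
    (le_self_pow₀ hL two_ne_zero).trans (le_add_of_nonneg_left (by positivity))
  unfold thresholdWeight
  gcongr

lemma mul_thresholdWeight_mul_sqrt_log_le (hn : 0 < n) (hK : 0 ≤ K) (hL : 1 ≤ Real.log n) :
    n * thresholdWeight K n s * √(Real.log n) ≤ K * (s * Real.log n + Real.log n ^ 3) := by
  have hR : √(Real.log n) ≤ Real.log n := Real.sqrt_le_self_iff.2 (Or.inr hL)
  calc n * thresholdWeight K n s * √(Real.log n)
      = K * (s * √(Real.log n) ^ 2 + Real.log n ^ 2 * √(Real.log n)) := by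
        rw [mul_thresholdWeight hn]
        ring
    _ ≤ K * (s * Real.log n + Real.log n ^ 2 * Real.log n) := by
        rw [sq_sqrt_log]
        gcongr
    _ = K * (s * Real.log n + Real.log n ^ 3) := by ring

lemma half_le_card_nullSet (hθ : θ ∈ sparseClass n s) (hs : 2 * (s : ℝ) ≤ n) :
    (n : ℝ) / 2 ≤ (nullSet θ).card := by
  have hcompl : ((nullSet θ)ᶜ.card : ℝ) ≤ s := by exact_mod_cast card_compl_nullSet_le hθ
  have hcard : ((nullSet θ).card : ℝ) + (nullSet θ)ᶜ.card = n := by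
    exact_mod_cast (Finset.card_add_card_compl (nullSet θ)).trans (Fintype.card_fin n)
  linarith

lemma chernoff_exponent_le (hn : 0 < n) (hK : 10 ^ 12 ≤ K) (hL : 1 ≤ Real.log n) {m : ℝ}
    (hm : n / 2 ≤ m) :
    thresholdWeight K n s / (384000 * (3 * √(Real.log n))) *
      (s / thresholdWeight K n s - m / (48000 * (3 * √(Real.log n)))) ≤ -(2 * Real.log n) := by
  have hmul := mul_thresholdWeight (K := K) (s := s) hn
  have hα0 : 0 < thresholdWeight K n s := by unfold thresholdWeight; positivity
  set α := thresholdWeight K n s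
  have hR2 := sq_sqrt_log n
  have hR : 0 < √(Real.log n) := Real.sqrt_pos.2 (by linarith)
  set R := √(Real.log n)
  have hdrift : K / 288000 * (s + R ^ 3) ≤ m * α / (144000 * R) :=
    calc K / 288000 * (s + R ^ 3) = n / 2 * α / (144000 * R) := by
          rw [← hR2] at hmul
          rw [div_mul_eq_mul_div (n : ℝ), hmul]
          field_simp
          norm_num
      _ ≤ m * α / (144000 * R) := by gcongr
  calc α / (384000 * (3 * R)) * (s / α - m / (48000 * (3 * R)))
      = (s - m * α / (144000 * R)) / (1152000 * R) := by
        field_simp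
        ring
    _ ≤ -(2 * R ^ 2) := by
        rw [div_le_iff₀ (by positivity)]
        have hR3 := pow_pos hR 3
        have hs : (0 : ℝ) ≤ s := s.cast_nonneg
        linarith [mul_le_mul_of_nonneg_right hK hs, mul_le_mul_of_nonneg_right hK hR3.le]
    _ = -(2 * Real.log n) := by rw [hR2]

lemma sq_mul_measureReal_score_le_one (hn : 0 < n) (hK : 10 ^ 12 ≤ K)
    (hL : 16 * K ^ 2 ≤ Real.log n) (hLn : 4 * K * Real.log n ^ 2 ≤ n) (hs : s * Real.log n ≤ n)
    (hθ : θ ∈ sparseClass n s) :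
    (n : ℝ) ^ 2 * (sampleLaw θ).real {X | -(s / thresholdWeight K n s) ≤
      ∑ i ∈ nullSet θ, score n (thresholdWeight K n s) (X i)} ≤ 1 := by
  have hn0 : (0 : ℝ) < n := by exact_mod_cast hn
  have hL2 : 2 ≤ Real.log n := by nlinarith
  have hR1 : 1 ≤ √(Real.log n) := Real.one_le_sqrt.2 (by linarith)
  have hTn : 24000 * (3 * √(Real.log n)) ≤ n := by
    have hRL : √(Real.log n) ≤ Real.log n ^ 2 :=
      (Real.sqrt_le_self_iff.2 (Or.inr (by linarith))).trans
        (le_self_pow₀ (by linarith) two_ne_zero)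
    nlinarith
  have h0 : 1 / (n : ℝ) ≤ thresholdWeight K n s :=
    (div_le_div_of_nonneg_right (by linarith : 1 ≤ 1 * Real.log n) hn0.le).trans
      (mul_log_div_le_thresholdWeight (by linarith) (by linarith) (by linarith))
  have hcard := half_le_card_nullSet hθ (by nlinarith [s.cast_nonneg (α := ℝ)])
  calc (n : ℝ) ^ 2 * (sampleLaw θ).real {X | -(s / thresholdWeight K n s) ≤
        ∑ i ∈ nullSet θ, score n (thresholdWeight K n s) (X i)}
      ≤ (n : ℝ) ^ 2 * Real.exp (-(2 * Real.log n)) := by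
        gcongr
        refine (measureReal_le_sum_nullSet_score_le hn h0 (thresholdWeight_le_half hn hL hLn hs)
          (T := 3 * √(Real.log n)) (by linarith) ?_ hTn θ _).trans
          (Real.exp_le_exp.2 (chernoff_exponent_le hn hK (by linarith) hcard))
        rw [mul_pow, sq_sqrt_log]
        linarith
    _ = 1 := by
        rw [Real.exp_neg, two_mul, Real.exp_add, Real.exp_log hn0, ← sq,
          mul_inv_cancel₀ (by positivity)]

lemma nullRisk_le_of_isMMLE (hn : 0 < n) (hc : 0 ≤ c) (hK : c + 10 ^ 12 ≤ K)
    (hL : 16 * K ^ 2 ≤ Real.log n) (hLn : 4 * K * Real.log n ^ 2 ≤ n) (h : IsMMLE c n αhat)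
    (hθ : θ ∈ sparseClass n s) (hs : s * Real.log n ≤ n) :
    nullRisk αhat θ ≤
      ENNReal.ofReal (1008 * K * (s * Real.log n + Real.log n ^ 3) + 13778) := by
  have hK0 : 0 < K := by linarith
  have hL1 : 1 ≤ Real.log n := by nlinarith
  have hmem : ∀ X, αhat X ∈ Set.Icc (0 : ℝ) 1 := fun X =>
    Set.Icc_subset_Icc_left (by positivity) (h X).1
  have hα0 : 0 < thresholdWeight K n s := by unfold thresholdWeight; positivity
  have hα2 := thresholdWeight_le_half hn hL hLn hs
  have htail := sq_mul_measureReal_score_le_one hn (by linarith) hL hLn hs hθ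
  have hmain := mul_thresholdWeight_mul_sqrt_log_le (s := s) hn hK0.le hL1
  refine (nullRisk_le hn hα0.le hα2 (T := 3 * √(Real.log n)) (by positivity) ?_ hmem θ
    (measurableSet_le measurable_const
      (Finset.measurable_sum _ fun i _ => measurable_score_eval n (thresholdWeight K n s) i))
    fun X hX => neg_div_le_sum_nullSet_score hn hα0 (by linarith) h
      (mul_log_div_le_thresholdWeight hK0.le (by linarith) hL1) hθ hX).trans
    (ENNReal.ofReal_le_ofReal ?_)
  · rw [mul_pow, sq_sqrt_log]
    linarith
  · linarith

lemma plugInRisk_le_of_isMMLE (hn : 0 < n) (hc : 1 ≤ c * Real.log n) (hK : c + 10 ^ 12 ≤ K)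
    (hL : 16 * K ^ 2 ≤ Real.log n) (hLn : 4 * K * Real.log n ^ 2 ≤ n) (h : IsMMLE c n αhat)
    (hθ : θ ∈ sparseClass n s) :
    plugInRisk αhat θ ≤ ENNReal.ofReal (1009 * K * (s * Real.log n + Real.log n ^ 3)) := by
  have hL0 : 0 ≤ Real.log n := Real.log_natCast_nonneg n
  have hc0 : 0 ≤ c := (pos_of_mul_pos_left (one_pos.trans_le hc) hL0).le
  have hK1 : 10 ^ 12 ≤ K := by linarith
  have hL1 : 1 ≤ Real.log n := by nlinarith
  have hmem : ∀ X, αhat X ∈ Set.Icc (1 / (n : ℝ)) 1 := fun X =>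
    Set.Icc_subset_Icc_left (by gcongr) (h X).1
  have hsL : 0 ≤ s * Real.log n := by positivity
  have hL3 : 1 ≤ Real.log n ^ 3 := one_le_pow₀ hL1
  have hrate := mul_le_mul_of_nonneg_right hK1 (by positivity : 0 ≤ s * Real.log n + Real.log n ^ 3)
  refine (plugInRisk_le hn hL1 hmem hθ).trans ?_
  rcases le_total (s * Real.log n) n with hs | hs
  · refine (add_le_add_right (nullRisk_le_of_isMMLE hn hc0 hK hL hLn h hθ hs) _).trans ?_
    rw [← ENNReal.ofReal_add (by positivity) (by positivity)]
    refine ENNReal.ofReal_le_ofReal ?_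
    linarith
  · refine (add_le_add_right (nullRisk_le_const_mul hn (fun X =>
      Set.Icc_subset_Icc_left (by positivity) (hmem X)) θ) _).trans ?_
    rw [← ENNReal.ofReal_add (by positivity) (by positivity)]
    refine ENNReal.ofReal_le_ofReal ?_
    linarith

lemma exists_forall_log_bounds (a : ℝ) {b : ℝ} (hb : 0 < b) :
    ∃ N : ℕ, 0 < N ∧ ∀ n : ℕ, N ≤ n → a ≤ Real.log n ∧ b * Real.log n ^ 2 ≤ n := by
  have hlarge : ∀ᶠ n : ℕ in Filter.atTop, a ≤ Real.log n :=
    (Real.tendsto_log_atTop.comp tendsto_natCast_atTop_atTop).eventually_ge_atTop a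
  have hsmall : ∀ᶠ n : ℕ in Filter.atTop, b * Real.log n ^ 2 ≤ n := by
    have hlittle := (Real.isLittleO_pow_log_id_atTop (n := 2)).comp_tendsto
      (tendsto_natCast_atTop_atTop (R := ℝ))
    filter_upwards [hlittle.bound (inv_pos.2 hb)] with n hn
    simp only [Function.comp_apply, id, Real.norm_eq_abs, abs_pow, sq_abs, Nat.abs_cast] at hn
    rwa [le_inv_mul_iff₀ hb] at hn
  obtain ⟨N, hN⟩ := Filter.eventually_atTop.1 (hlarge.and hsmall)
  exact ⟨N + 1, N.succ_pos, fun n hn => hN n (Nat.le_of_succ_le hn)⟩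

end

end

end SSL

theorem theorem4_general {𝒞 c₁ : ℝ} (h𝒞 : 0 < 𝒞) (hc₁ : 0 < c₁) :
    ∃ (C : ℝ) (N₀ : ℕ), 0 < C ∧ 0 < N₀ ∧
      ∀ n : ℕ, N₀ ≤ n → ∀ αhat : (Fin n → ℝ) → ℝ, SSL.IsMMLE 𝒞 n αhat →
        ∀ s : ℕ,
          (c₁ * Real.log n ^ 2 ≤ s →
            (⨆ θ₀ ∈ SSL.sparseClass n s, SSL.plugInRisk αhat θ₀) ≤
              ENNReal.ofReal (C * (s * Real.log n))) ∧
          (⨆ θ₀ ∈ SSL.sparseClass n s, SSL.plugInRisk αhat θ₀) ≤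
            ENNReal.ofReal (C * (s * Real.log n + Real.log n ^ 3)) := by
  set K : ℝ := 𝒞 + 10 ^ 12
  obtain ⟨N, hN0, hN⟩ :=
    SSL.exists_forall_log_bounds (max (16 * K ^ 2) (1 / 𝒞)) (by positivity : 0 < 4 * K)
  refine ⟨1009 * K * (1 + 1 / c₁), N, by positivity, hN0, fun n hn αhat h s => ?_⟩
  obtain ⟨hlog, hLn⟩ := hN n hn
  obtain ⟨hL, h𝒞L⟩ := max_le_iff.1 hlog
  have hL0 := Real.log_natCast_nonneg n
  have hrisk : (⨆ θ₀ ∈ SSL.sparseClass n s, SSL.plugInRisk αhat θ₀) ≤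
      ENNReal.ofReal (1009 * K * (s * Real.log n + Real.log n ^ 3)) :=
    iSup₂_le fun θ₀ hθ => SSL.plugInRisk_le_of_isMMLE (hN0.trans_le hn)
      ((div_le_iff₀' h𝒞).1 h𝒞L) le_rfl hL hLn h hθ
  refine ⟨fun hs => hrisk.trans (ENNReal.ofReal_le_ofReal ?_),
    hrisk.trans (ENNReal.ofReal_le_ofReal ?_)⟩ <;> rw [mul_assoc (1009 * K)] <;> gcongr
  · have hcube : Real.log n ^ 3 ≤ s * Real.log n / c₁ := by
      rw [le_div_iff₀ hc₁]
      linarith [mul_le_mul_of_nonneg_right hs hL0]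
    linarith [one_div_mul_eq_div c₁ (s * Real.log n)]
  · exact le_mul_of_one_le_left (by positivity) (by simpa using hc₁.le)

theorem theorem4 :
    ∃ 𝒞₀ : ℝ, 0 < 𝒞₀ ∧ ∀ 𝒞 : ℝ, 𝒞₀ ≤ 𝒞 →
      ∃ (C c₀ c₁ : ℝ) (N₀ : ℕ), 0 < C ∧ 0 < c₀ ∧ 0 < c₁ ∧ 0 < N₀ ∧
        ∀ n : ℕ, N₀ ≤ n → ∀ αhat : (Fin n → ℝ) → ℝ, SSL.IsMMLE 𝒞 n αhat →
          ∀ s : ℕ, (s : ℝ) ≤ c₀ * n →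
            (c₁ * Real.log n ^ 2 ≤ s →
              (⨆ θ₀ ∈ SSL.sparseClass n s, SSL.plugInRisk αhat θ₀) ≤
                ENNReal.ofReal (C * (s * Real.log n))) ∧
            (⨆ θ₀ ∈ SSL.sparseClass n s, SSL.plugInRisk αhat θ₀) ≤
              ENNReal.ofReal (C * (s * Real.log n + Real.log n ^ 3)) := by
  refine ⟨1, one_pos, fun 𝒞 h𝒞 => ?_⟩
  obtain ⟨C, N₀, hC, hN₀, h⟩ := theorem4_general (one_pos.trans_le h𝒞) one_pos
  exact ⟨C, 1, 1, N₀, hC, one_pos, one_pos, hN₀, fun n hn αhat hα s _ => h n hn αhat hα s⟩
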